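/- For finite simple graphs $G$ and $H$, let $\mathrm{ex}(G,H)$ be the maximum number of edges of an $H$-free subgraph of $G$ (containment of $H$ is not required to be induced), and let $\mathrm{ex}(n,H)=\mathrm{ex}(K_n,H)$. Let $G(n,p)$ be the random graph on $n$ labelled vertices in which each pair is an edge independently with probability $p$. For a graph $H$ with at least three vertices put \[ m_2(H)=\max\Big\{\frac{e(F)-1}{v(F)-2} : F\subseteq H,\ v(F)\ge 3\Big\},\qquad \lambda(\alpha,H)=\frac{1}{m_2(H)(2-\alpha)} \] (for $\alpha=2$, read $1/\lambda(\alpha,H)=0$). **Theorem 2.3.** Let $H$ be a finite bipartite graph that contains a cycle, and let $\alpha>0$. There is a constant $C>0$, depending only on $\alpha$ and $H$, such that the following holds. Suppose that $\mathrm{ex}(n,H)\le A n^{\alpha}$ for some real $A>0$ and every $n\in\mathbb{N}$. Then for every sequence $p=p(n)\in[0,1]$, with probability tending to $1$ as $n\to\infty$, \[ \mathrm{ex}(G(n,p),H)\le \begin{cases} C\,n^{2-1/m_2(H)} & \text{if } p\le n^{-1/m_2(H)},\\ C\,p^{1-1/\lambda(\alpha,H)}\,n^{\alpha} & \text{otherwise.}\end{cases}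 \] -/

import Mathlib

open Filter Topology
open scoped SimpleGraph

namespace RandomTuran

/-- The `2`-density `m₂(H) = max {(e(F) - 1) / (v(F) - 2) : F ⊆ H, v(F) ≥ 3}` of a finite graph `H`
with at least three vertices. There are only finitely many subgraphs `F`, so the supremum is a
maximum. -/
noncomputable def twoDensity {V : Type*} (H : SimpleGraph V) : ℝ :=
  ⨆ F : {F : H.Subgraph // 3 ≤ F.verts.ncard},
    ((F.1.edgeSet.ncard : ℝ) - 1) / ((F.1.verts.ncard : ℝ) - 2)

/-- The exponent parameter `λ(α, H) = 1 / (m₂(H) (2 - α))`. -/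
noncomputable def lam {V : Type*} (α : ℝ) (H : SimpleGraph V) : ℝ :=
  1 / (twoDensity H * (2 - α))

/-- `ex(G, H)`: the maximum number of edges of an `H`-free (not necessarily induced) subgraph of
the finite host graph `G`. -/
noncomputable def relEx {W V : Type*} (G : SimpleGraph W) (H : SimpleGraph V) : ℕ :=
  sSup {m : ℕ | ∃ G' : SimpleGraph W, G' ≤ G ∧ H.Free G' ∧ G'.edgeSet.ncard = m}

end RandomTuran

/-! Write μ = m₂(H). Three regimes are cheap. If p ≤ n^(-1/μ), or if α ≥ 2, the total number of
edges of G(n,p) is already small enough. If α ≤ 2 - 1/μ, the factor p^(1-1/λ) is at least 1 and the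
deterministic bound on ex(n,H) suffices. What remains is 2 - 1/μ < α < 2 with p above the threshold,
where λ > 1.

There, supersaturation comes from random transversals. Split the vertices into blocks of size m and
choose one position in each block. A graph U with N edges keeps about N/m² of them; once N is a
large multiple of A n^α m^(2-α), this beats the extremal bound on about n/m vertices, so a constant
proportion of the surviving edges can be packed into edge-disjoint copies of H. Averaging gives a
weighted hypergraph of copies in which a set S of edges has degree at most m^(-v(S)), and the
definition of m₂ turns this into m^(-2) q^(|S|-1) with q = m^(-1/μ) (`exists_spread_copies`). This
is the codegree condition of the container lemma `exists_container`: H-free subgraphs of U have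
fingerprints of size O(qN) and containers of size (1-δ)N.

With the largest admissible m one gets q = p (N/M)^(-λ) up to a constant, where M is of order
p^(-1/λ) n^α. As λ > 1, the sizes qN grow geometrically as N shrinks to M, so the last round
dominates: fingerprints have total size O(pM) and total weight ∑ p^|T| at most exp(O(pM)), with no
logarithmic loss (`exists_container_family`). A fingerprint must appear in G(n,p), at probability
p^|T|, and a container of size M meets G(n,p) in more than K pM edges with probability exponentially
small in pM. The union bound `measureReal_lt_relEx_le_of_family` finishes, as pM is of order
p^(1-1/λ) n^α and at least n. -/

namespace RandomTuran

/-! ### Containers for weighted hypergraphs. -/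

section Containers

universe u

variable {V : Type u} [Fintype V] [DecidableEq V]

/-- The weighted degree of a set `S` in the weighted hypergraph `w`. -/
noncomputable def weightDeg (w : Finset V → ℝ) (S : Finset V) : ℝ :=
  ∑ E, if S ⊆ E then w E else 0

/-- The set `I` contains no edge of positive weight. -/
def Indep (w : Finset V → ℝ) (I : Finset V) : Prop := ∀ E ⊆ I, w E = 0

/-- The fingerprint `T` and the output `f` computed from `I` can be recovered from any set between
the fingerprint of `I` and `I`. -/
structure IsFingerprint (T f : Finset V → Finset V) : Prop where
  subset : ∀ I, T I ⊆ I
  consistent : ∀ I J, T I ⊆ J → J ⊆ I → T J = T I ∧ f J = f I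

/-- A nonnegative weighted `i`-uniform hypergraph on `U` with codegrees bounded by
`D * q ^ (|S| - 1)`. -/
structure IsSpread (i : ℕ) (U : Finset V) (D q : ℝ) (w : Finset V → ℝ) : Prop where
  nonneg : ∀ E, 0 ≤ w E
  supp : ∀ E, w E ≠ 0 → E ⊆ U ∧ E.card = i
  deg_le : ∀ S, S.Nonempty → weightDeg w S ≤ D * q ^ (S.card - 1)

/-- The link of `v`. -/
def link (w : Finset V → ℝ) (v : V) : Finset V → ℝ :=
  fun F => if v ∈ F then 0 else w (insert v F)

open Classical in
/-- The part of `w` that avoids the sets saturated in `g`. -/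
noncomputable def residual (w g : Finset V → ℝ) (D q : ℝ) : Finset V → ℝ :=
  fun E => if ∀ S ⊆ E, S.Nonempty → weightDeg g S < D * q ^ S.card then w E else 0

lemma sum_link_aux (w : Finset V → ℝ) (v : V) (P : Finset V → Prop)
    [DecidablePred P] :
    ∑ F, (if P F then link w v F else 0) = ∑ E, if v ∈ E ∧ P (E.erase v) then w E else 0 := by
  have h1 : ∀ F, (if P F then link w v F else 0) =
      if v ∉ F ∧ P F then w (insert v F) else 0 := by
    intro F; unfold link; split_ifs <;> simp_all
  simp_rw [h1]
  rw [← Finset.sum_filter, ← Finset.sum_filter]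
  refine Finset.sum_bij' (fun F _ => insert v F) (fun E _ => E.erase v) ?_ ?_ ?_ ?_ ?_
  · intro F hF; simp only [Finset.mem_filter, Finset.mem_univ, true_and] at hF ⊢
    simp [Finset.erase_insert hF.1, hF.2]
  · intro E hE; simp only [Finset.mem_filter, Finset.mem_univ, true_and] at hE ⊢
    simp [hE.2]
  · intro F hF; simp only [Finset.mem_filter, Finset.mem_univ, true_and] at hF
    exact Finset.erase_insert hF.1
  · intro E hE; simp only [Finset.mem_filter, Finset.mem_univ, true_and] at hE
    exact Finset.insert_erase hE.1
  · intro F _; rfl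

lemma sum_link (w : Finset V → ℝ) (v : V) : ∑ F, link w v F = weightDeg w {v} := by
  have := sum_link_aux w v (fun _ => True)
  simpa [weightDeg] using this

lemma weightDeg_link (w : Finset V → ℝ) (v : V) (S : Finset V) :
    weightDeg (link w v) S = if v ∈ S then 0 else weightDeg w (insert v S) := by
  have := sum_link_aux w v (fun F => S ⊆ F)
  unfold weightDeg
  rw [this]
  split_ifs with hv
  · refine Finset.sum_eq_zero fun E _ => if_neg ?_
    rintro ⟨_, h⟩
    simpa using h hv
  · refine Finset.sum_congr rfl fun E _ => ?_
    refine if_congr ?_ rfl rfl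
    rw [Finset.insert_subset_iff, Finset.subset_erase]
    tauto

lemma weightDeg_mono {w w' : Finset V → ℝ} (h : ∀ E, w E ≤ w' E) (S : Finset V) :
    weightDeg w S ≤ weightDeg w' S := by
  refine Finset.sum_le_sum fun E _ => ?_
  split_ifs
  · exact h E
  · exact le_rfl

lemma weightDeg_nonneg {w : Finset V → ℝ} (h : ∀ E, 0 ≤ w E) (S : Finset V) :
    0 ≤ weightDeg w S :=
  Finset.sum_nonneg fun E _ => by split_ifs; exacts [h E, le_rfl]

lemma weightDeg_add (w w' : Finset V → ℝ) (S : Finset V) :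
    weightDeg (fun E => w E + w' E) S = weightDeg w S + weightDeg w' S := by
  unfold weightDeg
  rw [← Finset.sum_add_distrib]
  exact Finset.sum_congr rfl fun E _ => by split_ifs <;> simp

lemma residual_le {w : Finset V → ℝ} (hw : ∀ E, 0 ≤ w E) (g : Finset V → ℝ) (D q : ℝ)
    (E : Finset V) : residual w g D q E ≤ w E := by
  unfold residual; split_ifs; exacts [le_rfl, hw E]

lemma residual_nonneg {w : Finset V → ℝ} (hw : ∀ E, 0 ≤ w E) (g : Finset V → ℝ) (D q : ℝ)
    (E : Finset V) : 0 ≤ residual w g D q E := by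
  unfold residual; split_ifs; exacts [hw E, le_rfl]

lemma ne_zero_of_residual {w g : Finset V → ℝ} {D q : ℝ} {E : Finset V}
    (h : residual w g D q E ≠ 0) : w E ≠ 0 := by
  unfold residual at h; split_ifs at h; exacts [h, absurd rfl h]

lemma weightDeg_residual_eq_zero {w g : Finset V → ℝ} {D q : ℝ} {S : Finset V} (hS : S.Nonempty)
    (hg : D * q ^ S.card ≤ weightDeg g S) {S' : Finset V} (h : S ⊆ S') :
    weightDeg (residual w g D q) S' = 0 := by
  refine Finset.sum_eq_zero fun E _ => ?_
  split_ifs with hE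
  · exact if_neg fun H => absurd (H S (h.trans hE) hS) (not_lt.2 hg)
  · rfl

/-- Adding the link of a vertex in the residual hypergraph keeps the codegrees bounded. -/
lemma IsSpread.add_link {i : ℕ} {U : Finset V} {D q : ℝ} {w g : Finset V → ℝ}
    (hw : IsSpread (i + 1) U D q w) (hg : IsSpread i U (2 * D * q) q g) (v : V) :
    IsSpread i U (2 * D * q) q (fun F => g F + link (residual w g D q) v F) := by
  have hl : ∀ F, 0 ≤ link (residual w g D q) v F := fun F => by
    unfold link; split_ifs; exacts [le_rfl, residual_nonneg hw.nonneg _ _ _ _]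
  refine ⟨fun F => add_nonneg (hg.nonneg F) (hl F), fun F hF => ?_, fun S hS => ?_⟩
  · by_cases h : g F = 0
    · rw [h, zero_add] at hF
      unfold link at hF
      split_ifs at hF with hv
      · exact absurd rfl hF
      · obtain ⟨h1, h2⟩ := hw.supp _ (ne_zero_of_residual hF)
        rw [Finset.card_insert_of_notMem hv] at h2
        exact ⟨(Finset.subset_insert _ _).trans h1, by omega⟩
    · exact hg.supp F h
  · rw [weightDeg_add, weightDeg_link]
    split_ifs with hv
    · simpa using hg.deg_le S hS
    · have hc := hS.card_pos
      have hpow : q * q ^ (S.card - 1) = q ^ S.card := by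
        rw [← pow_succ']; congr 1; omega
      -- Saturation is declared at half the permitted degree 2Dq^|S|. A saturated set gains nothing,
      -- and an unsaturated one gains at most the other half.
      rcases le_or_gt (D * q ^ S.card) (weightDeg g S) with h | h
      · rw [weightDeg_residual_eq_zero hS h (Finset.subset_insert _ _), add_zero]
        exact hg.deg_le S hS
      · have h2 : weightDeg (residual w g D q) (insert v S) ≤ D * q ^ S.card := by
          refine (weightDeg_mono (residual_le hw.nonneg g D q) _).trans ?_
          have := hw.deg_le (insert v S) (Finset.insert_nonempty _ _)
          rwa [Finset.card_insert_of_notMem hv, Nat.add_sub_cancel] at this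
        calc _ ≤ D * q ^ S.card + D * q ^ S.card := by linarith
          _ = _ := by rw [← hpow]; ring

lemma Indep.add_link {w g : Finset V → ℝ} {D q : ℝ} {I : Finset V} (hw : Indep w I)
    (hg : Indep g I) {v : V} (hv : v ∈ I) :
    Indep (fun F => g F + link (residual w g D q) v F) I := by
  intro F hF
  have : link (residual w g D q) v F = 0 := by
    unfold link
    split_ifs
    · rfl
    · by_contra h
      exact ne_zero_of_residual h (hw _ (Finset.insert_subset hv hF))
  simp [hg F hF, this]

lemma sum_weightDeg {i : ℕ} {U : Finset V} {D q : ℝ} {g : Finset V → ℝ}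
    (hg : IsSpread i U D q g) : ∑ S, weightDeg g S = 2 ^ i * ∑ F, g F := by
  unfold weightDeg
  rw [Finset.sum_comm, Finset.mul_sum]
  refine Finset.sum_congr rfl fun F _ => ?_
  rw [← Finset.sum_filter, Finset.sum_const, nsmul_eq_mul]
  by_cases h : g F = 0
  · simp [h]
  · have : (Finset.univ.filter fun S => S ⊆ F) = F.powerset := by ext; simp
    rw [this, Finset.card_powerset, (hg.supp F h).2]
    push_cast; rfl

lemma sum_weightDeg_singleton {i : ℕ} {U : Finset V} {w : Finset V → ℝ}
    (hw : ∀ E, w E ≠ 0 → E ⊆ U ∧ E.card = i) :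
    ∑ v ∈ U, weightDeg w {v} = i * ∑ E, w E := by
  unfold weightDeg
  rw [Finset.sum_comm, Finset.mul_sum]
  refine Finset.sum_congr rfl fun E _ => ?_
  rw [← Finset.sum_filter, Finset.sum_const, nsmul_eq_mul]
  by_cases h : w E = 0
  · simp [h]
  · have : (U.filter fun v => {v} ⊆ E) = E := by
      ext v; simpa using fun hv => (hw E h).1 hv
    rw [this, (hw E h).2]

/-- The weight lost by passing to the residual hypergraph. -/
lemma sum_sub_residual_le {i : ℕ} {U : Finset V} {D q : ℝ} {w g : Finset V → ℝ} (hq : 0 < q)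
    (hw : IsSpread (i + 1) U D q w) (hg : IsSpread i U (2 * D * q) q g) :
    ∑ E, w E - ∑ E, residual w g D q E ≤ 2 ^ i * (∑ F, g F) / q := by
  classical
  -- Each deleted edge is charged to a saturated subset S. Such S carries w-degree at most D
  -- q^(|S|-1), hence at most its g-degree divided by q.
  have hpt : ∀ E, w E - residual w g D q E ≤
      ∑ S, if S ⊆ E ∧ S.Nonempty ∧ D * q ^ S.card ≤ weightDeg g S then w E else 0 := by
    intro E
    have hnn : ∀ S : Finset V, 0 ≤ (if S ⊆ E ∧ S.Nonempty ∧ D * q ^ S.card ≤ weightDeg g S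
        then w E else 0) := fun S => by split_ifs; exacts [hw.nonneg E, le_rfl]
    by_cases h : ∀ S ⊆ E, S.Nonempty → weightDeg g S < D * q ^ S.card
    · have : residual w g D q E = w E := if_pos h
      rw [this, sub_self]
      exact Finset.sum_nonneg fun S _ => hnn S
    · have h0 : residual w g D q E = 0 := if_neg h
      push Not at h
      obtain ⟨S, h1, h2, h3⟩ := h
      rw [h0, sub_zero]
      have := Finset.single_le_sum (fun S _ => hnn S) (Finset.mem_univ S)
      simpa [h1, h2, h3] using this
  rw [← Finset.sum_sub_distrib]
  refine (Finset.sum_le_sum fun E _ => hpt E).trans ?_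
  rw [Finset.sum_comm, ← sum_weightDeg hg, Finset.sum_div]
  refine Finset.sum_le_sum fun S _ => ?_
  by_cases h : S.Nonempty ∧ D * q ^ S.card ≤ weightDeg g S
  · have : (∑ E, if S ⊆ E ∧ S.Nonempty ∧ D * q ^ S.card ≤ weightDeg g S then w E else 0) =
        weightDeg w S :=
      Finset.sum_congr rfl fun E _ => if_congr (and_iff_left h) rfl rfl
    rw [this, le_div_iff₀ hq]
    calc weightDeg w S * q ≤ D * q ^ (S.card - 1) * q :=
          mul_le_mul_of_nonneg_right (hw.deg_le S h.1) hq.le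
      _ = D * q ^ S.card := by
          rw [mul_assoc, ← pow_succ]; congr 2; have := h.1.card_pos; omega
      _ ≤ _ := h.2
  · rw [Finset.sum_eq_zero fun E _ => if_neg fun H => h H.2]
    exact div_nonneg (weightDeg_nonneg hg.nonneg S) hq.le

/-- If `g` has small total weight, then many vertices have large degree in the residual
hypergraph. -/
lemma card_low_degree_le {i : ℕ} {U : Finset V} {c D q : ℝ} {w g : Finset V → ℝ} (hq : 0 < q)
    (hD : 0 < D) (hw : IsSpread (i + 1) U D q w) (hg : IsSpread i U (2 * D * q) q g)
    (hc : 0 < c) (htot : c * D * U.card ≤ ∑ E, w E)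
    (hlow : ∑ F, g F ≤ c / 2 ^ (i + 1) * D * q * U.card) :
    ((U.filter fun v => weightDeg (residual w g D q) {v} < c / 4 * D).card : ℝ) ≤
      (1 - c / 4) * U.card := by
  have h1 := sum_sub_residual_le hq hw hg
  have h2 : 2 ^ i * (∑ F, g F) / q ≤ c * D * U.card / 2 := by
    rw [div_le_iff₀ hq]
    calc 2 ^ i * (∑ F, g F) ≤ 2 ^ i * (c / 2 ^ (i + 1) * D * q * U.card) := by gcongr
      _ = _ := by rw [pow_succ]; field_simp
  have h3 := sum_weightDeg_singleton (U := U) (i := i + 1) (w := residual w g D q)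
    fun E hE => hw.supp E (ne_zero_of_residual hE)
  have h4 : 0 ≤ ∑ E, residual w g D q E :=
    Finset.sum_nonneg fun E _ => residual_nonneg hw.nonneg _ _ _ _
  have h5 : c * D * U.card / 2 ≤ ∑ v ∈ U, weightDeg (residual w g D q) {v} := by
    rw [h3]; push_cast
    nlinarith [mul_nonneg (Nat.cast_nonneg (α := ℝ) i) h4]
  have h6 : ∀ v, weightDeg (residual w g D q) {v} ≤ D := fun v => by
    have := hw.deg_le {v} (by simp)
    simp only [Finset.card_singleton, Nat.sub_self, pow_zero, mul_one] at this
    exact (weightDeg_mono (residual_le hw.nonneg g D q) _).trans this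
  set B := U.filter fun v => weightDeg (residual w g D q) {v} < c / 4 * D
  set B' := U.filter fun v => ¬ weightDeg (residual w g D q) {v} < c / 4 * D
  -- No degree exceeds D, so a degree sum of at least cD|U|/2 forces at least c|U|/4 vertices
  -- outside B.
  have h7 : ∑ v ∈ U, weightDeg (residual w g D q) {v} ≤ B.card * (c / 4 * D) + B'.card * D := by
    rw [← Finset.sum_filter_add_sum_filter_not U
      (fun v => weightDeg (residual w g D q) {v} < c / 4 * D)]
    refine add_le_add ?_ ?_
    · rw [← nsmul_eq_mul]
      exact Finset.sum_le_card_nsmul _ _ _ fun v hv => (Finset.mem_filter.1 hv).2.le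
    · rw [← nsmul_eq_mul]
      exact Finset.sum_le_card_nsmul _ _ _ fun v _ => h6 v
  have h8 : (B.card : ℝ) + B'.card = U.card := by
    exact_mod_cast Finset.card_filter_add_card_filter_not (s := U) _
  have h9 : (c * U.card / 2) * D ≤ (U.card * (c / 4) + B'.card) * D := by
    have : (B.card : ℝ) * (c / 4 * D) ≤ U.card * (c / 4 * D) := by
      have : (B.card : ℝ) ≤ U.card := by exact_mod_cast Finset.card_filter_le _ _
      gcongr
    nlinarith
  have := le_of_mul_le_mul_right h9 hD
  nlinarith

/-- Querying a set `A`: the fingerprint records the first vertex of `A ∩ I`, if there is one. -/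
lemma IsFingerprint.query {A C : Finset V} {T f : V → Finset V → Finset V}
    (h : ∀ v, IsFingerprint (T v) (f v)) :
    ∃ T' f' : Finset V → Finset V, IsFingerprint T' f' ∧
      (∀ I, Disjoint A I → T' I = ∅ ∧ f' I = C) ∧
      ∀ I, ¬ Disjoint A I → ∃ v ∈ A ∩ I, T' I = insert v (T v I) ∧ f' I = f v I := by
  classical
  let rk := Fintype.equivFin V
  have key : ∀ I, ∃ o : Option V, (Disjoint A I → o = none) ∧
      (¬ Disjoint A I → ∃ v ∈ A ∩ I, o = some v ∧ ∀ u ∈ A ∩ I, rk v ≤ rk u) := by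
    intro I
    by_cases hd : Disjoint A I
    · exact ⟨none, fun _ => rfl, fun h => absurd hd h⟩
    · rw [Finset.not_disjoint_iff_nonempty_inter] at hd
      obtain ⟨v, hv, hmin⟩ := Finset.exists_min_image (A ∩ I) rk hd
      refine ⟨some v, fun h => ?_, fun _ => ⟨v, hv, rfl, hmin⟩⟩
      rw [Finset.disjoint_iff_inter_eq_empty] at h
      simp [h] at hv
  choose o ho1 ho2 using key
  refine ⟨fun I => (o I).elim ∅ fun v => insert v (T v I), fun I => (o I).elim C fun v => f v I,
    ⟨fun I => ?_, fun I J hTJ hJI => ?_⟩, fun I hI => by simp [ho1 I hI], fun I hI => ?_⟩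
  · by_cases hd : Disjoint A I
    · simp [ho1 I hd]
    · obtain ⟨v, hv, hov, -⟩ := ho2 I hd
      simp only [hov, Option.elim_some]
      exact Finset.insert_subset (Finset.mem_inter.1 hv).2 ((h v).subset I)
  · by_cases hd : Disjoint A I
    · simp [ho1 I hd, ho1 J (hd.mono_right hJI)]
    · obtain ⟨v, hv, hov, hmin⟩ := ho2 I hd
      simp only [hov, Option.elim_some] at hTJ ⊢
      have hvJ : v ∈ A ∩ J := Finset.mem_inter.2
        ⟨(Finset.mem_inter.1 hv).1, hTJ (Finset.mem_insert_self _ _)⟩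
      have hdJ : ¬ Disjoint A J := by
        rw [Finset.not_disjoint_iff_nonempty_inter]; exact ⟨v, hvJ⟩
      obtain ⟨u, hu, hou, hminu⟩ := ho2 J hdJ
      -- The first vertex of A ∩ I lies in J because it is in the fingerprint, and shrinking I to J
      -- creates no earlier one.
      have huv : u = v := rk.injective (le_antisymm (hminu v hvJ)
        (hmin u (Finset.inter_subset_inter_left hJI hu)))
      subst huv
      simp only [hou, Option.elim_some]
      obtain ⟨h1, h2⟩ := (h u).consistent I J ((Finset.subset_insert _ _).trans hTJ) hJI
      rw [h1, h2]; exact ⟨rfl, rfl⟩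
  · obtain ⟨v, hv, hov, -⟩ := ho2 I hI
    exact ⟨v, hv, by simp [hov], by simp [hov]⟩

/-- `(T, f)` is a container system for the weighted hypergraph `w` on `U`. -/
structure IsContainer (U : Finset V) (w : Finset V → ℝ) (t s : ℝ) (T f : Finset V → Finset V) :
    Prop extends IsFingerprint T f where
  spec : ∀ I ⊆ U, Indep w I → ((T I).card : ℝ) ≤ t ∧ I ⊆ f I ∧ f I ⊆ U ∧ ((f I).card : ℝ) ≤ s

/-- One round of the container algorithm, reducing the uniformity by one. -/
lemma exists_container_round {i : ℕ} {U : Finset V} {c δ t D q : ℝ} {w : Finset V → ℝ}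
    (hq : 0 < q) (hD : 0 < D) (hw : IsSpread (i + 1) U D q w) (hc : 0 < c) (hδc : δ ≤ c / 4)
    (ht : 0 ≤ t) (htot : c * D * U.card ≤ ∑ E, w E)
    (ih : ∀ g, IsSpread i U (2 * D * q) q g → c / 2 ^ (i + 1) * D * q * U.card ≤ ∑ F, g F →
      ∃ T f, IsContainer U g t ((1 - δ) * U.card) T f) (j : ℕ) :
    ∀ g, IsSpread i U (2 * D * q) q g →
      c / 2 ^ (i + 1) * D * q * U.card ≤ ∑ F, g F + j * (c / 4 * D) →
      ∃ T f, IsFingerprint T f ∧ ∀ I ⊆ U, Indep w I → Indep g I →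
        ((T I).card : ℝ) ≤ t + j ∧ I ⊆ f I ∧ f I ⊆ U ∧ ((f I).card : ℝ) ≤ (1 - δ) * U.card := by
  -- Here j is the number of queries still allowed. Each successful query adds at least (c/4)D to
  -- the weight of g, so g is heavy enough for the lower uniformity when j reaches 0.
  induction j with
  | zero =>
    intro g hg hj
    obtain ⟨T, f, h⟩ := ih g hg (by simpa using hj)
    exact ⟨T, f, h.toIsFingerprint, fun I hI _ hgI => by simpa using h.spec I hI hgI⟩
  | succ j hj =>
    intro g hg hjg
    rcases le_or_gt (c / 2 ^ (i + 1) * D * q * U.card) (∑ F, g F) with hlarge | hsmall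
    · obtain ⟨T, f, h⟩ := ih g hg hlarge
      refine ⟨T, f, h.toIsFingerprint, fun I hI _ hgI => ?_⟩
      obtain ⟨h1, h2⟩ := h.spec I hI hgI
      exact ⟨h1.trans (le_add_of_nonneg_right (by positivity)), h2⟩
    have hcard := card_low_degree_le hq hD hw hg hc htot hsmall.le
    set r := residual w g D q with hr
    set A := U.filter fun v => c / 4 * D ≤ weightDeg r {v} with hA
    have hstep : ∀ v, ∃ T f, IsFingerprint T f ∧ (v ∈ A → ∀ I ⊆ U, Indep w I →
        Indep (fun F => g F + link r v F) I →
        ((T I).card : ℝ) ≤ t + j ∧ I ⊆ f I ∧ f I ⊆ U ∧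
          ((f I).card : ℝ) ≤ (1 - δ) * U.card) := by
      intro v
      by_cases hv : v ∈ A
      · obtain ⟨T, f, h1, h2⟩ := hj _ (hw.add_link hg v) (by
          rw [Finset.sum_add_distrib, sum_link]
          have := (Finset.mem_filter.1 hv).2
          push_cast at hjg
          linarith)
        exact ⟨T, f, h1, fun _ => h2⟩
      · exact ⟨fun _ => ∅, fun _ => ∅, ⟨fun _ => by simp, fun _ _ _ _ => ⟨rfl, rfl⟩⟩,
          fun h => absurd h hv⟩
    choose T f hTf hspec using hstep
    obtain ⟨T', f', hfp, hdis, hndis⟩ := IsFingerprint.query (A := A)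
      (C := U.filter fun v => weightDeg r {v} < c / 4 * D) hTf
    refine ⟨T', f', hfp, fun I hI hwI hgI => ?_⟩
    -- If I misses every high-degree vertex, the low-degree vertices form its container. Otherwise
    -- the queried vertex lies in I, so adding its link keeps I independent.
    by_cases hd : Disjoint A I
    · obtain ⟨e1, e2⟩ := hdis I hd
      rw [e1, e2]
      refine ⟨by simp; positivity, fun v hv => ?_, Finset.filter_subset _ _, hcard.trans ?_⟩
      · refine Finset.mem_filter.2 ⟨hI hv, ?_⟩
        by_contra hlt
        exact Finset.disjoint_left.1 hd (Finset.mem_filter.2 ⟨hI hv, not_lt.1 hlt⟩) hv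
      · gcongr
    · obtain ⟨v, hv, e1, e2⟩ := hndis I hd
      rw [e1, e2]
      obtain ⟨hvA, hvI⟩ := Finset.mem_inter.1 hv
      obtain ⟨h1, h2⟩ := hspec v hvA I hI hwI (hwI.add_link hgI hvI)
      refine ⟨?_, h2⟩
      have : ((insert v (T v I)).card : ℝ) ≤ (T v I).card + 1 := by
        exact_mod_cast Finset.card_insert_le _ _
      push_cast; linarith

/-- **Hypergraph container lemma** for spread weighted hypergraphs. -/
theorem exists_container (i : ℕ) : ∀ c : ℝ, 0 < c → ∃ δ : ℝ, 0 < δ ∧ δ < 1 ∧ ∃ L : ℝ, 0 < L ∧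
    ∀ (V : Type u) [Fintype V] [DecidableEq V] (U : Finset V) (D q : ℝ) (w : Finset V → ℝ),
      0 < q → 0 < D → 1 ≤ q * U.card → IsSpread i U D q w → c * D * U.card ≤ ∑ E, w E →
      ∃ T f, IsContainer U w (L * (q * U.card)) ((1 - δ) * U.card) T f := by
  induction i with
  | zero =>
    intro c hc
    refine ⟨1 / 2, by norm_num, by norm_num, 1, one_pos, fun V _ _ U D q w hq hD hqU hw htot => ?_⟩
    refine ⟨fun _ => ∅, fun _ => ∅, ⟨fun _ => by simp, fun _ _ _ _ => ⟨rfl, rfl⟩⟩,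
      fun I _ hI => ?_⟩
    -- In uniformity 0 all the weight sits on the empty set, which lies in every I, so no set is
    -- independent.
    exfalso
    have hU : (0 : ℝ) < U.card := by
      by_contra h
      nlinarith [mul_nonneg hq.le (sub_nonneg.2 (not_lt.1 h))]
    have : ∑ E, w E = 0 := by
      refine Finset.sum_eq_zero fun E _ => ?_
      by_contra h
      have h0 := (hw.supp E h).2
      rw [Finset.card_eq_zero] at h0
      subst h0
      exact h (hI _ (Finset.empty_subset _))
    rw [this] at htot
    have : 0 < c * D * U.card := by positivity
    linarith
  | succ i ih =>
    intro c hc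
    -- The extra factor 1/2 compensates for the degree parameter 2Dq of g. In the fingerprint
    -- constant below, 4 pays for the queries and 1 for rounding up, absorbed through 1 ≤ q|U|.
    obtain ⟨δ, hδ, hδ1, L, hL, H⟩ := ih (c / 2 ^ (i + 1) / 2) (by positivity)
    refine ⟨min δ (c / 4), by positivity, (min_le_left _ _).trans_lt hδ1, L + 5, by positivity,
      fun V _ _ U D q w hq hD hqU hw htot => ?_⟩
    obtain ⟨T, f, hTf, hspec⟩ := exists_container_round (δ := min δ (c / 4))
      (t := L * (q * U.card)) hq hD hw hc (min_le_right _ _) (by positivity) htot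
      (fun g hg hgt => by
        obtain ⟨T, f, h⟩ := H V U (2 * D * q) q g hq (by positivity) hqU hg
          (le_of_eq_of_le (by ring) hgt)
        refine ⟨T, f, h.toIsFingerprint, fun I hI hgI => ?_⟩
        obtain ⟨h1, h2, h3, h4⟩ := h.spec I hI hgI
        refine ⟨h1, h2, h3, h4.trans ?_⟩
        gcongr
        exact min_le_left _ _)
      ⌈4 / 2 ^ (i + 1) * (q * U.card)⌉₊ (fun _ => 0)
      ⟨fun _ => le_rfl, fun _ h => absurd rfl h, fun S _ => by
        unfold weightDeg; simp; positivity⟩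
      (by
        have := Nat.le_ceil (4 / 2 ^ (i + 1) * (q * U.card))
        calc c / 2 ^ (i + 1) * D * q * U.card
            = 4 / 2 ^ (i + 1) * (q * U.card) * (c / 4 * D) := by field_simp
          _ ≤ ⌈4 / 2 ^ (i + 1) * (q * U.card)⌉₊ * (c / 4 * D) := by gcongr
          _ = _ := by simp)
    refine ⟨T, f, hTf, fun I hI hwI => ?_⟩
    obtain ⟨h1, h2⟩ := hspec I hI hwI fun _ _ => rfl
    refine ⟨h1.trans ?_, h2⟩
    have h3 := (Nat.ceil_lt_add_one (a := 4 / 2 ^ (i + 1) * (q * U.card)) (by positivity)).le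
    have h4 : (4 : ℝ) / 2 ^ (i + 1) ≤ 4 := by
      apply div_le_self (by norm_num)
      exact one_le_pow₀ (by norm_num)
    have h5 : 4 / 2 ^ (i + 1) * (q * U.card) ≤ 4 * (q * U.card) := by gcongr
    linarith

end Containers

/-! ### Iterating containers without logarithmic loss. -/

section Families

universe u

variable {V : Type u}

/-- A Chernoff-type bound: y^(|T|-t) ≥ 1 for every T counted, and the sum of (py)^|T| over all
subsets factorises. -/
lemma sum_pow_card_le (U : Finset V) {p y : ℝ} (hp : 0 ≤ p) (hy : 0 < y) (hy1 : y ≤ 1) (t : ℝ) :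
    ∑ T ∈ U.powerset with (T.card : ℝ) ≤ t, p ^ T.card ≤
      y ^ (-t) * Real.exp (p * y * U.card) := by
  calc ∑ T ∈ U.powerset with (T.card : ℝ) ≤ t, p ^ T.card
      ≤ ∑ T ∈ U.powerset with (T.card : ℝ) ≤ t, y ^ (-t) * (p * y) ^ T.card := by
        refine Finset.sum_le_sum fun T hT => ?_
        have hT' := (Finset.mem_filter.1 hT).2
        have h1 : 1 ≤ y ^ (-t) * y ^ T.card := by
          rw [← Real.rpow_natCast, ← Real.rpow_add hy]
          exact Real.one_le_rpow_of_pos_of_le_one_of_nonpos hy hy1 (by linarith)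
        calc p ^ T.card = p ^ T.card * 1 := (mul_one _).symm
          _ ≤ p ^ T.card * (y ^ (-t) * y ^ T.card) := by gcongr
          _ = _ := by rw [mul_pow]; ring
    _ ≤ ∑ T ∈ U.powerset, y ^ (-t) * (p * y) ^ T.card :=
        Finset.sum_le_sum_of_subset_of_nonneg (Finset.filter_subset _ _)
          fun T _ _ => by positivity
    _ = y ^ (-t) * (1 + p * y) ^ U.card := by
        rw [← Finset.mul_sum]
        congr 1
        have := Finset.prod_one_add (f := fun _ : V => p * y) U
        simp only [Finset.prod_const] at this
        exact this.symm
    _ ≤ _ := by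
        gcongr
        rw [mul_comm (p * y), Real.exp_nat_mul]
        gcongr
        linarith [Real.add_one_le_exp (p * y)]

/-- The total weight of the possible fingerprints when passing from a set of size `r * M` to a
smaller one. -/
lemma sum_fingerprints_le (U : Finset V) {p M L l ε r : ℝ} (hp : 0 ≤ p) (hM : 0 < M)
    (hL : 0 < L) (hε : 0 < ε) (hl : l = 1 + 2 * ε) (hr : 1 ≤ r) (hU : (U.card : ℝ) = r * M) :
    ∑ T ∈ U.powerset with (T.card : ℝ) ≤ L * (p * r ^ (-l) * U.card), p ^ T.card ≤
      Real.exp ((l * L / ε + 1) * p * M * r ^ (-ε)) := by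
  have hr0 : 0 < r := by linarith
  refine (sum_pow_card_le U hp (Real.rpow_pos_of_pos hr0 (-l))
    (Real.rpow_le_one_of_one_le_of_nonpos hr (by linarith)) _).trans ?_
  have h1 : r ^ (-l) * r = r ^ (-ε) * r ^ (-ε) := by
    rw [← Real.rpow_add hr0, ← Real.rpow_add_one hr0.ne']; congr 1; linarith
  have h2 : r ^ (-ε) ≤ 1 := Real.rpow_le_one_of_one_le_of_nonpos hr (by linarith)
  have h3 : 0 < r ^ (-ε) := Real.rpow_pos_of_pos hr0 _
  -- The entropy of the fingerprints costs a factor log r, paid with r^ε. Since r^(1-l) = r^(-2ε), a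
  -- decay r^(-ε) is left over.
  have h4 : Real.log r ≤ r ^ ε / ε := Real.log_le_rpow_div hr0.le hε
  have h5 : r ^ (-ε) * r ^ ε = 1 := by rw [← Real.rpow_add hr0]; simp
  rw [Real.rpow_def_of_pos (Real.rpow_pos_of_pos hr0 _), ← Real.exp_add, Real.log_rpow hr0, hU]
  refine Real.exp_le_exp.2 ?_
  calc -l * Real.log r * -(L * (p * r ^ (-l) * (r * M))) + p * r ^ (-l) * (r * M)
      = (l * L * Real.log r + 1) * p * M * (r ^ (-l) * r) := by ring
    _ ≤ (l * L * (r ^ ε / ε) + 1) * p * M * (r ^ (-l) * r) := by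
        have : 0 ≤ l := by linarith
        gcongr
    _ = l * L / ε * p * M * r ^ (-ε) * (r ^ (-ε) * r ^ ε) + p * M * r ^ (-ε) * r ^ (-ε) := by
        rw [h1]; ring
    _ ≤ l * L / ε * p * M * r ^ (-ε) * 1 + p * M * r ^ (-ε) * 1 := by
        rw [h5]; gcongr
    _ = _ := by ring

variable [DecidableEq V]

/-- Iterating a container step whose fingerprints shrink polynomially with the size of the ambient
set: the independent sets in `U` are captured by a family of fingerprints `T` and containers `C`
with `|C| ≤ M`. -/
theorem exists_container_family_aux {ind : Finset V → Prop}
    (hind : ∀ I J, J ⊆ I → ind I → ind J) {M p δ L l ε : ℝ} (hM : 0 < M) (hp : 0 < p)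
    (hδ : 0 < δ) (hδ1 : δ < 1) (hL : 0 < L) (hε : 0 < ε) (hl : l = 1 + 2 * ε)
    {E : Finset V} (step : ∀ U ⊆ E, M < U.card → ∃ T f : Finset V → Finset V, IsFingerprint T f ∧
      ∀ I ⊆ U, ind I → ((T I).card : ℝ) ≤ L * (p * (U.card / M) ^ (-l) * U.card) ∧
        I ⊆ f I ∧ f I ⊆ U ∧ ((f I).card : ℝ) ≤ (1 - δ) * U.card) (j : ℕ) :
    ∀ U ⊆ E, U.card * (1 - δ) ^ j ≤ M →
      ∃ (ι : Type u) (_ : Fintype ι) (T C : ι → Finset V),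
        (∀ i, T i ⊆ U ∧ C i ⊆ U ∧ Disjoint (T i) (C i) ∧ ((C i).card : ℝ) ≤ M ∧
          ((T i).card : ℝ) ≤ L * p * M * ∑ a ∈ Finset.range j, ((1 - δ) ^ ε) ^ a) ∧
        ∑ i, p ^ (T i).card ≤
          Real.exp ((l * L / ε + 1) * p * M * ∑ a ∈ Finset.range j, ((1 - δ) ^ ε) ^ a) ∧
        ∀ I ⊆ U, ind I → ∃ i, T i ⊆ I ∧ I ⊆ T i ∪ C i := by
  have hδ0 : 0 < 1 - δ := by linarith
  have hl0 : 0 ≤ l := by linarith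
  set x : ℝ := (1 - δ) ^ ε with hx
  have hx0 : 0 < x := Real.rpow_pos_of_pos hδ0 _
  induction j with
  | zero =>
    intro U _ hU
    refine ⟨PUnit, inferInstance, fun _ => ∅, fun _ => U, fun _ => ?_, by simp, fun I hI _ => ?_⟩
    · simpa using hU
    · exact ⟨⟨⟩, by simp, by simpa using hI⟩
  | succ j ih =>
    intro U hUE hU
    by_cases hUj : U.card * (1 - δ) ^ j ≤ M
    · obtain ⟨ι, hι, T, C, h1, h2, h3⟩ := ih U hUE hUj
      have hle : ∑ a ∈ Finset.range j, x ^ a ≤ ∑ a ∈ Finset.range (j + 1), x ^ a := by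
        rw [Finset.sum_range_succ]; linarith [pow_pos hx0 j]
      refine ⟨ι, hι, T, C, fun i => ?_, h2.trans ?_, h3⟩
      · obtain ⟨a1, a2, a3, a4, a5⟩ := h1 i
        refine ⟨a1, a2, a3, a4, a5.trans ?_⟩
        gcongr
      · gcongr
    push Not at hUj
    set r : ℝ := U.card / M with hr
    have hUr : (U.card : ℝ) = r * M := by rw [hr]; field_simp
    have hrj : 1 / (1 - δ) ^ j ≤ r := by
      rw [hr, div_le_div_iff₀ (by positivity) hM, one_mul]; exact hUj.le
    have hr1 : 1 ≤ r := le_trans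
      (by rw [le_div_iff₀ (by positivity), one_mul]; exact pow_le_one₀ hδ0.le (by linarith)) hrj
    have hr0 : 0 < r := by linarith
    have hMU : M < U.card := by
      refine hUj.trans_le ?_
      exact mul_le_of_le_one_right (Nat.cast_nonneg _) (pow_le_one₀ hδ0.le (by linarith))
    -- Needing more than j rounds means r > (1-δ)^(-j), so this round contributes only the j-th term
    -- of a geometric series.
    have hrx : r ^ (-ε) ≤ x ^ j := by
      rw [Real.rpow_neg hr0.le, hx, ← Real.rpow_natCast, ← Real.rpow_mul hδ0.le, mul_comm,
        Real.rpow_mul hδ0.le, Real.rpow_natCast]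
      refine inv_le_of_inv_le₀ (by positivity) ?_
      rw [← Real.inv_rpow (by positivity), ← one_div]
      gcongr
    obtain ⟨T, f, hTf, hspec⟩ := step U hUE hMU
    set t : ℝ := L * (p * r ^ (-l) * U.card) with ht
    have htx : t ≤ L * p * M * x ^ j := by
      have : r ^ (-l) * r ≤ x ^ j := by
        refine le_trans ?_ hrx
        rw [← Real.rpow_add_one hr0.ne']
        exact Real.rpow_le_rpow_of_exponent_le hr1 (by linarith)
      calc t = L * p * M * (r ^ (-l) * r) := by rw [ht, hUr]; ring
        _ ≤ _ := by gcongr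
    let S : Finset (Finset V) := U.powerset.filter fun T₁ =>
      (T₁.card : ℝ) ≤ t ∧ f T₁ ⊆ U ∧ ((f T₁).card : ℝ) ≤ (1 - δ) * U.card
    have hS : ∀ T₁ : S, T₁.1 ⊆ U ∧ (T₁.1.card : ℝ) ≤ t ∧ f T₁ ⊆ U ∧
        ((f T₁).card : ℝ) ≤ (1 - δ) * U.card := fun T₁ => by
      have := Finset.mem_filter.1 T₁.2
      exact ⟨Finset.mem_powerset.1 this.1, this.2⟩
    -- Removing T₁ before recursing makes the pieces of the final fingerprint disjoint, so sizes add
    -- and the weights p^|T| multiply.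
    have hsub : ∀ T₁ : S, f T₁ \ T₁ ⊆ U := fun T₁ => Finset.sdiff_subset.trans (hS T₁).2.2.1
    have hrec := fun T₁ : S => ih (f T₁ \ T₁) ((hsub T₁).trans hUE) (by
      have h1 : ((f T₁ \ T₁.1).card : ℝ) ≤ (f T₁).card := by
        exact_mod_cast Finset.card_le_card Finset.sdiff_subset
      calc ((f T₁ \ T₁.1).card : ℝ) * (1 - δ) ^ j ≤ (1 - δ) * U.card * (1 - δ) ^ j := by
            gcongr; exact h1.trans (hS T₁).2.2.2
        _ = U.card * (1 - δ) ^ (j + 1) := by ring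
        _ ≤ M := hU)
    choose ι hι T' C' h1 h2 h3 using hrec
    have hdisj : ∀ (T₁ : S) (i : ι T₁), Disjoint T₁.1 (T' T₁ i) := fun T₁ i =>
      Finset.disjoint_of_subset_right (h1 T₁ i).1 Finset.disjoint_sdiff
    refine ⟨Σ T₁ : S, ι T₁, inferInstance, fun i => i.1.1 ∪ T' i.1 i.2, fun i => C' i.1 i.2,
      ?_, ?_, ?_⟩
    · rintro ⟨T₁, i⟩
      obtain ⟨a1, a2, a3, a4, a5⟩ := h1 T₁ i
      refine ⟨Finset.union_subset (hS T₁).1 (a1.trans (hsub T₁)), a2.trans (hsub T₁), ?_, a4, ?_⟩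
      · exact Finset.disjoint_union_left.2
          ⟨Finset.disjoint_of_subset_right a2 Finset.disjoint_sdiff, a3⟩
      · dsimp only
        rw [Finset.card_union_of_disjoint (hdisj T₁ i), Finset.sum_range_succ]
        push_cast
        have := (hS T₁).2.1
        linarith
    · rw [Fintype.sum_sigma]
      calc ∑ T₁ : S, ∑ i, p ^ (T₁.1 ∪ T' T₁ i).card
          = ∑ T₁ : S, p ^ T₁.1.card * ∑ i, p ^ (T' T₁ i).card := by
            refine Finset.sum_congr rfl fun T₁ _ => ?_
            rw [Finset.mul_sum]
            refine Finset.sum_congr rfl fun i _ => ?_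
            rw [Finset.card_union_of_disjoint (hdisj T₁ i), pow_add]
        _ ≤ ∑ T₁ : S, p ^ T₁.1.card * Real.exp ((l * L / ε + 1) * p * M *
              ∑ a ∈ Finset.range j, x ^ a) := by
            gcongr with T₁; exact h2 T₁
        _ = (∑ T₁ ∈ S, p ^ T₁.card) * Real.exp ((l * L / ε + 1) * p * M *
              ∑ a ∈ Finset.range j, x ^ a) := by
            rw [← Finset.sum_mul, Finset.sum_coe_sort S fun T₁ => p ^ T₁.card]
        _ ≤ Real.exp ((l * L / ε + 1) * p * M * x ^ j) * Real.exp ((l * L / ε + 1) * p * M *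
              ∑ a ∈ Finset.range j, x ^ a) := by
            gcongr
            calc ∑ T₁ ∈ S, p ^ T₁.card
                ≤ ∑ T₁ ∈ U.powerset with (T₁.card : ℝ) ≤ t, p ^ T₁.card := by
                  refine Finset.sum_le_sum_of_subset_of_nonneg (fun T₁ hT₁ => ?_)
                    fun _ _ _ => by positivity
                  have := Finset.mem_filter.1 hT₁
                  exact Finset.mem_filter.2 ⟨this.1, this.2.1⟩
              _ ≤ Real.exp ((l * L / ε + 1) * p * M * r ^ (-ε)) :=
                  sum_fingerprints_le U hp.le hM hL hε hl hr1 hUr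
              _ ≤ _ := by gcongr
        _ = _ := by
            rw [← Real.exp_add, Finset.sum_range_succ]; congr 1; ring
    · intro I hI hiI
      obtain ⟨b1, b2, b3, b4⟩ := hspec I hI hiI
      have hTI := hTf.subset I
      have hf : f (T I) = f I := (hTf.consistent I (T I) subset_rfl hTI).2
      -- Consistency gives f (T I) = f I, so containers can be indexed by fingerprints alone.
      have hmem : T I ∈ S := Finset.mem_filter.2
        ⟨Finset.mem_powerset.2 (hTI.trans hI), b1, by rwa [hf], by rwa [hf]⟩
      obtain ⟨i, c1, c2⟩ := h3 ⟨T I, hmem⟩ (I \ T I)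
        (Finset.sdiff_subset_sdiff (by rw [hf]; exact b2) subset_rfl)
        (hind _ _ Finset.sdiff_subset hiI)
      refine ⟨⟨⟨T I, hmem⟩, i⟩, Finset.union_subset hTI (c1.trans Finset.sdiff_subset), ?_⟩
      intro v hv
      by_cases hvT : v ∈ T I
      · simp [hvT]
      · have := c2 (Finset.mem_sdiff.2 ⟨hv, hvT⟩)
        simp only [Finset.mem_union] at this ⊢
        tauto

/-- Summing the geometric series with ratio (1-δ)^ε removes the dependence on the number of rounds.
-/
theorem exists_container_family {ind : Finset V → Prop}
    (hind : ∀ I J, J ⊆ I → ind I → ind J) {M p δ L l ε : ℝ} (hM : 0 < M) (hp : 0 < p)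
    (hδ : 0 < δ) (hδ1 : δ < 1) (hL : 0 < L) (hε : 0 < ε) (hl : l = 1 + 2 * ε)
    {E : Finset V} (step : ∀ U ⊆ E, M < U.card → ∃ T f : Finset V → Finset V, IsFingerprint T f ∧
      ∀ I ⊆ U, ind I → ((T I).card : ℝ) ≤ L * (p * (U.card / M) ^ (-l) * U.card) ∧
        I ⊆ f I ∧ f I ⊆ U ∧ ((f I).card : ℝ) ≤ (1 - δ) * U.card) :
    ∃ (ι : Type u) (_ : Fintype ι) (T C : ι → Finset V),
      (∀ i, T i ⊆ E ∧ C i ⊆ E ∧ Disjoint (T i) (C i) ∧ ((C i).card : ℝ) ≤ M ∧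
        ((T i).card : ℝ) ≤ L / (1 - (1 - δ) ^ ε) * (p * M)) ∧
      ∑ i, p ^ (T i).card ≤ Real.exp ((l * L / ε + 1) / (1 - (1 - δ) ^ ε) * (p * M)) ∧
      ∀ I ⊆ E, ind I → ∃ i, T i ⊆ I ∧ I ⊆ T i ∪ C i := by
  have hδ0 : 0 < 1 - δ := by linarith
  have hl0 : 0 ≤ l := by linarith
  have hx0 : 0 < (1 - δ) ^ ε := Real.rpow_pos_of_pos hδ0 _
  have hx1 : (1 - δ) ^ ε < 1 := Real.rpow_lt_one hδ0.le (by linarith) hε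
  have hgeom : ∀ j, ∑ a ∈ Finset.range j, ((1 - δ) ^ ε) ^ a ≤ 1 / (1 - (1 - δ) ^ ε) := fun j => by
    rw [one_div, ← tsum_geometric_of_lt_one hx0.le hx1]
    exact (summable_geometric_of_lt_one hx0.le hx1).sum_le_tsum _ fun _ _ => by positivity
  obtain ⟨j, hj⟩ : ∃ j : ℕ, E.card * (1 - δ) ^ j ≤ M := by
    have : Tendsto (fun j : ℕ => (E.card : ℝ) * (1 - δ) ^ j) atTop (𝓝 (E.card * 0)) :=
      (tendsto_pow_atTop_nhds_zero_of_lt_one hδ0.le (by linarith)).const_mul _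
    rw [mul_zero] at this
    exact (this.eventually_le_const hM).exists
  obtain ⟨ι, hι, T, C, h1, h2, h3⟩ :=
    exists_container_family_aux hind hM hp hδ hδ1 hL hε hl step j E subset_rfl hj
  refine ⟨ι, hι, T, C, fun i => ?_, h2.trans ?_, h3⟩
  · obtain ⟨a1, a2, a3, a4, a5⟩ := h1 i
    refine ⟨a1, a2, a3, a4, a5.trans ?_⟩
    calc _ ≤ L * p * M * (1 / (1 - (1 - δ) ^ ε)) := by gcongr; exact hgeom j
      _ = _ := by ring
  · refine Real.exp_le_exp.2 ?_
    calc _ ≤ (l * L / ε + 1) * p * M * (1 / (1 - (1 - δ) ^ ε)) := by gcongr; exact hgeom j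
      _ = _ := by ring

end Families

/-! ### Tail bounds for the binomial random graph. -/

section Probability

open MeasureTheory

/-- Exponential Markov inequality for the binomial random graph, together with the event that a
given set of pairs is present. -/
lemma measureReal_fingerprint_le {n : ℕ} (p : unitInterval) {T C : Finset (Sym2 (Fin n))}
    (hT : ∀ e ∈ T, ¬ e.IsDiag) (hC : ∀ e ∈ C, ¬ e.IsDiag) (hTC : Disjoint T C) (b : ℝ) :
    G(Fin n, p).real {G : SimpleGraph (Fin n) | (T : Set (Sym2 (Fin n))) ⊆ G.edgeSet ∧
      b ≤ ((C : Set (Sym2 (Fin n))) ∩ G.edgeSet).ncard} ≤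
      (p : ℝ) ^ T.card * (2 ^ (-b) * Real.exp (p * C.card)) := by
  classical
  set E : Finset (Sym2 (Fin n)) := Finset.univ.filter fun e => ¬ e.IsDiag with hE
  set f : Sym2 (Fin n) → ℝ := fun e => if e ∈ C then 2 * p else p with hf
  set g : Sym2 (Fin n) → ℝ := fun e => if e ∈ T then 0 else 1 - p with hg
  have hp0 : (0 : ℝ) ≤ p := p.2.1
  have hp1 : (0 : ℝ) ≤ 1 - p := sub_nonneg.2 p.2.2
  have hf0 : ∀ e, 0 ≤ f e := fun e => by simp only [hf]; split_ifs <;> positivity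
  have hg0 : ∀ e, 0 ≤ g e := fun e => by simp only [hg]; split_ifs <;> simp [p.2.2]
  have hEcard : E.card = n.choose 2 := by
    have := Sym2.card_diagSet_compl (α := Fin n)
    rw [Fintype.card_fin] at this
    rw [← this, ← Set.toFinset_card]
    congr 1; ext e; simp [hE]
  set S : Set (SimpleGraph (Fin n)) := {G | (T : Set (Sym2 (Fin n))) ⊆ G.edgeSet ∧
      b ≤ ((C : Set (Sym2 (Fin n))) ∩ G.edgeSet).ncard}
  have hterm : ∀ G ∈ S, G(Fin n, p).real {G} ≤
      2 ^ (-b) * ((∏ e ∈ G.edgeFinset, f e) * ∏ e ∈ E \ G.edgeFinset, g e) := by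
    intro G hG
    obtain ⟨h1, h2⟩ := hG
    have hGE : G.edgeFinset ⊆ E := fun e he => by
      simp only [hE, Finset.mem_filter, Finset.mem_univ, true_and]
      exact G.not_isDiag_of_mem_edgeFinset he
    have hcard : G.edgeSet.ncard = G.edgeFinset.card := by
      rw [← SimpleGraph.coe_edgeFinset, Set.ncard_coe_finset]
    have hprob : G(Fin n, p).real {G} =
        (p : ℝ) ^ G.edgeFinset.card * (1 - p) ^ (E \ G.edgeFinset).card := by
      rw [measureReal_def, SimpleGraph.binomialRandom_singleton, Finset.card_sdiff_of_subset hGE,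
        hEcard, hcard]
      simp
    have hprodg : ∏ e ∈ E \ G.edgeFinset, g e = (1 - p : ℝ) ^ (E \ G.edgeFinset).card := by
      rw [← Finset.prod_const]
      refine Finset.prod_congr rfl fun e he => if_neg fun heT => ?_
      exact (Finset.mem_sdiff.1 he).2 (SimpleGraph.mem_edgeFinset.2 (h1 heT))
    have hprodf : ∏ e ∈ G.edgeFinset, f e =
        2 ^ (C ∩ G.edgeFinset).card * (p : ℝ) ^ G.edgeFinset.card := by
      have : ∀ e, f e = (if e ∈ C then 2 else 1) * p := fun e => by
        simp only [hf]; split_ifs <;> ring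
      simp_rw [this]
      rw [Finset.prod_mul_distrib, Finset.prod_const, Finset.prod_ite_mem, Finset.prod_const,
        Finset.inter_comm]
    have hb : b ≤ (C ∩ G.edgeFinset).card := by
      rw [← SimpleGraph.coe_edgeFinset, ← Finset.coe_inter, Set.ncard_coe_finset] at h2
      exact h2
    have h3 : (1 : ℝ) ≤ 2 ^ (-b) * 2 ^ (C ∩ G.edgeFinset).card := by
      rw [← Real.rpow_natCast, ← Real.rpow_add two_pos]
      exact Real.one_le_rpow one_le_two (by linarith)
    rw [hprob, hprodg, hprodf]
    calc (p : ℝ) ^ G.edgeFinset.card * (1 - p) ^ (E \ G.edgeFinset).card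
        = 1 * ((p : ℝ) ^ G.edgeFinset.card * (1 - p) ^ (E \ G.edgeFinset).card) := by ring
      _ ≤ (2 ^ (-b) * 2 ^ (C ∩ G.edgeFinset).card) *
          ((p : ℝ) ^ G.edgeFinset.card * (1 - p) ^ (E \ G.edgeFinset).card) := by gcongr
      _ = _ := by ring
  have hnn : ∀ R : Finset (Sym2 (Fin n)), 0 ≤ (∏ e ∈ R, f e) * ∏ e ∈ E \ R, g e := fun R =>
    mul_nonneg (Finset.prod_nonneg fun e _ => hf0 e) (Finset.prod_nonneg fun e _ => hg0 e)
  calc G(Fin n, p).real S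
      ≤ ∑ G ∈ S.toFinset, G(Fin n, p).real {G} := by
        have := measureReal_biUnion_finset_le (μ := G(Fin n, p)) S.toFinset fun G => {G}
        simpa using this
    _ ≤ ∑ G ∈ S.toFinset,
          2 ^ (-b) * ((∏ e ∈ G.edgeFinset, f e) * ∏ e ∈ E \ G.edgeFinset, g e) :=
        Finset.sum_le_sum fun G hG => hterm G (Set.mem_toFinset.1 hG)
    _ = 2 ^ (-b) * ∑ R ∈ S.toFinset.image fun G => G.edgeFinset,
          (∏ e ∈ R, f e) * ∏ e ∈ E \ R, g e := by
        rw [Finset.sum_image fun G _ G' _ h => SimpleGraph.edgeFinset_inj.1 h, Finset.mul_sum]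
    _ ≤ 2 ^ (-b) * ∑ R ∈ E.powerset, (∏ e ∈ R, f e) * ∏ e ∈ E \ R, g e := by
        refine mul_le_mul_of_nonneg_left ?_ (by positivity)
        refine Finset.sum_le_sum_of_subset_of_nonneg ?_ fun R _ _ => hnn R
        intro R hR
        obtain ⟨G, -, rfl⟩ := Finset.mem_image.1 hR
        refine Finset.mem_powerset.2 fun e he => ?_
        simp only [hE, Finset.mem_filter, Finset.mem_univ, true_and]
        exact G.not_isDiag_of_mem_edgeFinset he
    _ = 2 ^ (-b) * ∏ e ∈ E, (f e + g e) := by rw [Finset.prod_add]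
    _ = 2 ^ (-b) * ((∏ e ∈ E, if e ∈ T then (p : ℝ) else 1) *
          ∏ e ∈ E, if e ∈ C then (1 + p : ℝ) else 1) := by
        rw [← Finset.prod_mul_distrib]
        congr 1
        refine Finset.prod_congr rfl fun e _ => ?_
        by_cases h1 : e ∈ T
        · have h2 := Finset.disjoint_left.1 hTC h1
          simp [hf, hg, h1, h2]
        · by_cases h2 : e ∈ C
          · simp [hf, hg, h1, h2]; ring
          · simp [hf, hg, h1, h2]
    _ = 2 ^ (-b) * ((p : ℝ) ^ T.card * (1 + p) ^ C.card) := by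
        have hTE : E ∩ T = T := Finset.inter_eq_right.2 fun e he => by simpa [hE] using hT e he
        have hCE : E ∩ C = C := Finset.inter_eq_right.2 fun e he => by simpa [hE] using hC e he
        rw [Finset.prod_ite_mem, Finset.prod_ite_mem, Finset.prod_const, Finset.prod_const,
          hTE, hCE]
    _ ≤ 2 ^ (-b) * ((p : ℝ) ^ T.card * Real.exp (p * C.card)) := by
        gcongr
        rw [mul_comm (p : ℝ), Real.exp_nat_mul]
        gcongr
        linarith [Real.add_one_le_exp (p : ℝ)]
    _ = _ := by ring

lemma card_le_sq {n : ℕ} (U : Finset (Sym2 (Fin n))) : (U.card : ℝ) ≤ n ^ 2 := by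
  have h1 : U.card ≤ (Finset.univ : Finset (Fin n × Fin n)).card := by
    refine (Finset.card_le_univ U).trans ?_
    exact Finset.card_le_card_of_surjOn (fun x => s(x.1, x.2)) fun e _ => by
      induction e with
      | _ x y => exact ⟨(x, y), by simp, rfl⟩
  rw [Finset.card_univ, Fintype.card_prod, Fintype.card_fin] at h1
  rw [pow_two]; exact_mod_cast h1

/-- The random graph rarely has many more edges than expected. -/
lemma measureReal_edges_le (n : ℕ) (p : unitInterval) (b : ℝ) :
    G(Fin n, p).real {G : SimpleGraph (Fin n) | b ≤ G.edgeSet.ncard} ≤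
      2 ^ (-b) * Real.exp (p * n ^ 2) := by
  classical
  set E : Finset (Sym2 (Fin n)) := Finset.univ.filter fun e => ¬ e.IsDiag with hE
  have h := measureReal_fingerprint_le p (T := ∅) (C := E) (by simp)
    (fun e he => by simpa [hE] using he) (by simp) b
  have hcard := card_le_sq E
  have hset : ∀ G : SimpleGraph (Fin n), (E : Set (Sym2 (Fin n))) ∩ G.edgeSet = G.edgeSet := by
    intro G
    refine Set.inter_eq_right.2 fun e he => ?_
    simpa [hE] using G.not_isDiag_of_mem_edgeSet he
  simp only [Finset.coe_empty, Set.empty_subset, true_and, Finset.card_empty, pow_zero,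
    one_mul, hset] at h
  refine h.trans ?_
  have : (0 : ℝ) ≤ p := p.2.1
  gcongr

end Probability

/-! ### Edge sets of copies of H and the 2-density. -/

section Copies

variable {W : Type*} {α : Type*}

/-- `E` is the edge set of a copy of `H`. -/
def IsCopyEdges (H : SimpleGraph W) (E : Finset (Sym2 α)) : Prop :=
  ∃ f : W ↪ α, (E : Set (Sym2 α)) = Sym2.map f '' H.edgeSet

lemma IsCopyEdges.card_eq {H : SimpleGraph W} {E : Finset (Sym2 α)} (h : IsCopyEdges H E) :
    E.card = H.edgeSet.ncard := by
  obtain ⟨f, hf⟩ := h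
  rw [← Set.ncard_coe_finset, hf, Set.ncard_image_of_injective _ (Sym2.map.injective f.injective)]

lemma IsCopyEdges.not_free {H : SimpleGraph W} {E : Finset (Sym2 α)} (h : IsCopyEdges H E)
    {G : SimpleGraph α} (hE : (E : Set (Sym2 α)) ⊆ G.edgeSet) : ¬ H.Free G := by
  obtain ⟨f, hf⟩ := h
  rw [SimpleGraph.not_free]
  refine ⟨⟨⟨f, fun {a b} hab => ?_⟩, f.injective⟩⟩
  have : Sym2.map f s(a, b) ∈ G.edgeSet := hE (hf ▸ Set.mem_image_of_mem _ hab)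
  simpa using this

lemma le_twoDensity [Finite W] {H : SimpleGraph W} (F : H.Subgraph) (hF : 3 ≤ F.verts.ncard) :
    ((F.edgeSet.ncard : ℝ) - 1) / ((F.verts.ncard : ℝ) - 2) ≤ twoDensity H :=
  le_ciSup (f := fun F : {F : H.Subgraph // 3 ≤ F.verts.ncard} =>
    ((F.1.edgeSet.ncard : ℝ) - 1) / ((F.1.verts.ncard : ℝ) - 2))
    (Set.finite_range _).bddAbove ⟨F, hF⟩

/-- The subgraph formed by a set of edges and the vertices they cover. -/
def edgeSubgraph (H : SimpleGraph W) (S : Set (Sym2 W)) : H.Subgraph where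
  verts := {v | ∃ e ∈ S ∩ H.edgeSet, v ∈ e}
  Adj u v := s(u, v) ∈ S ∩ H.edgeSet
  adj_sub h := h.2
  edge_vert h := ⟨_, h, Sym2.mem_mk_left _ _⟩
  symm := ⟨fun u v h => by rwa [Sym2.eq_swap]⟩

lemma edgeSet_edgeSubgraph (H : SimpleGraph W) (S : Set (Sym2 W)) :
    (edgeSubgraph H S).edgeSet = S ∩ H.edgeSet := by
  ext e
  induction e with
  | _ u v => rfl

/-- A cycle contains a path with two edges on three vertices, whose density ratio is exactly 1. -/
lemma one_le_twoDensity [Finite W] {H : SimpleGraph W} (h : ¬ H.IsAcyclic) :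
    1 ≤ twoDensity H := by
  simp only [SimpleGraph.IsAcyclic, not_forall, not_not] at h
  obtain ⟨v, c, hc⟩ := h
  have h3 := hc.three_le_length
  have hab : H.Adj (c.getVert 0) (c.getVert 1) := c.adj_getVert_succ (by omega)
  have hbd : H.Adj (c.getVert 1) (c.getVert 2) := c.adj_getVert_succ (by omega)
  have hne : c.getVert 0 ≠ c.getVert 2 := fun h => by
    have := hc.getVert_injOn' (x₁ := 0) (x₂ := 2) (by simp) (by simp; omega) h
    omega
  generalize c.getVert 0 = a at *
  generalize c.getVert 1 = b at *
  generalize c.getVert 2 = d at *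
  set F := edgeSubgraph H {s(a, b), s(b, d)} with hF
  have he : F.edgeSet = {s(a, b), s(b, d)} := by
    rw [hF, edgeSet_edgeSubgraph]
    refine Set.inter_eq_left.2 ?_
    rintro e (rfl | rfl)
    exacts [hab, hbd]
  have hv : F.verts = {a, b, d} := by
    ext x
    change (∃ e ∈ _ ∩ _, x ∈ e) ↔ _
    constructor
    · rintro ⟨e, ⟨rfl | rfl, -⟩, hx⟩ <;> simp at hx ⊢ <;> tauto
    · rintro (rfl | rfl | rfl)
      · exact ⟨s(x, b), ⟨by simp, hab⟩, by simp⟩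
      · exact ⟨s(a, x), ⟨by simp, hab⟩, by simp⟩
      · exact ⟨s(b, x), ⟨by simp, hbd⟩, by simp⟩
  have hec : F.edgeSet.ncard = 2 := by
    rw [he]; refine Set.ncard_pair fun h => ?_
    rw [Sym2.eq_iff] at h
    rcases h with ⟨h1, h2⟩ | ⟨h1, h2⟩
    · exact hab.ne h1
    · exact hne h1
  have hvc : F.verts.ncard = 3 := by
    rw [hv, Set.ncard_eq_three]
    exact ⟨a, b, d, hab.ne, hne, hbd.ne, rfl⟩
  have := le_twoDensity F hvc.ge
  rw [hec, hvc] at this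
  norm_num at this
  exact this

variable [DecidableEq α]

/-- The vertices covered by a set of edges. -/
def cover (S : Finset (Sym2 α)) : Finset α := S.biUnion Sym2.toFinset

lemma mem_cover {S : Finset (Sym2 α)} {v : α} : v ∈ cover S ↔ ∃ e ∈ S, v ∈ e := by
  simp [cover]

lemma two_le_card_cover {S : Finset (Sym2 α)} (hS : ∀ e ∈ S, ¬ e.IsDiag) (h : S.Nonempty) :
    2 ≤ (cover S).card := by
  obtain ⟨e, he⟩ := h
  rw [← Sym2.card_toFinset_of_not_isDiag e (hS e he)]
  exact Finset.card_le_card fun v hv => mem_cover.2 ⟨e, he, Sym2.mem_toFinset.1 hv⟩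

lemma three_le_card_cover {S : Finset (Sym2 α)} (hS : ∀ e ∈ S, ¬ e.IsDiag) (h : 2 ≤ S.card) :
    3 ≤ (cover S).card := by
  obtain ⟨e, he, e', he', hne⟩ := Finset.one_lt_card.1 h
  by_contra hlt
  have key : ∀ e ∈ S, e.toFinset = cover S := fun e he =>
    Finset.eq_of_subset_of_card_le (fun v hv => mem_cover.2 ⟨e, he, Sym2.mem_toFinset.1 hv⟩) (by
      rw [Sym2.card_toFinset_of_not_isDiag e (hS e he)]; omega)
  refine hne (Sym2.ext fun v => ?_)
  rw [← Sym2.mem_toFinset, ← Sym2.mem_toFinset, key e he, key e' he']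

/-- The defining property of the `2`-density, for sets of edges inside a copy of `H`. -/
lemma IsCopyEdges.card_le [Finite W] {H : SimpleGraph W} {E S : Finset (Sym2 α)}
    (h : IsCopyEdges H E) (hSE : S ⊆ E) (hE : ∀ e ∈ E, ¬ e.IsDiag) (hS : S.Nonempty) :
    (S.card : ℝ) - 1 ≤ twoDensity H * ((cover S).card - 2) := by
  have hS' : ∀ e ∈ S, ¬ e.IsDiag := fun e he => hE e (hSE he)
  -- A single edge covers only two vertices, so it is outside the range of the supremum; there both
  -- sides vanish.
  rcases Nat.lt_or_ge S.card 2 with hc | hc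
  · have h1 : S.card = 1 := by have := hS.card_pos; omega
    obtain ⟨e, rfl⟩ := Finset.card_eq_one.1 h1
    have : (cover {e}).card = 2 := by
      simpa [cover] using Sym2.card_toFinset_of_not_isDiag e (hS' e (by simp))
    simp [this]
  obtain ⟨f, hf⟩ := h
  set F := edgeSubgraph H (Sym2.map f ⁻¹' S) with hF
  have hinj := Sym2.map.injective f.injective
  have he : Sym2.map f '' F.edgeSet = S := by
    rw [hF, edgeSet_edgeSubgraph, Set.image_preimage_inter, ← hf]
    exact Set.inter_eq_left.2 (by exact_mod_cast hSE)
  have hec : F.edgeSet.ncard = S.card := by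
    rw [← Set.ncard_image_of_injective _ hinj, he, Set.ncard_coe_finset]
  have hv : f '' F.verts = cover S := by
    ext x
    simp only [Set.mem_image, Finset.mem_coe, mem_cover]
    constructor
    · rintro ⟨y, ⟨e, ⟨h1, -⟩, h2⟩, rfl⟩
      exact ⟨Sym2.map f e, h1, Sym2.mem_map.2 ⟨y, h2, rfl⟩⟩
    · rintro ⟨e, h1, h2⟩
      have h3 : e ∈ Sym2.map f '' H.edgeSet := by rw [← hf]; exact hSE h1
      obtain ⟨e', h4, rfl⟩ := h3
      obtain ⟨y, h5, rfl⟩ := Sym2.mem_map.1 h2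
      exact ⟨y, ⟨e', ⟨h1, h4⟩, h5⟩, rfl⟩
  have hvc : F.verts.ncard = (cover S).card := by
    rw [← Set.ncard_image_of_injective _ f.injective, hv, Set.ncard_coe_finset]
  have h3 := three_le_card_cover hS' hc
  have := le_twoDensity F (hvc ▸ h3)
  rw [hec, hvc, div_le_iff₀] at this
  · exact this
  · have : (3 : ℝ) ≤ (cover S).card := by exact_mod_cast h3
    linarith

/-- A set of edges spanning few vertices and exceeding the extremal bound contains a copy. -/
lemma exists_isCopyEdges {H : SimpleGraph W} {A a : ℝ} (hA : 0 ≤ A) (ha : 0 ≤ a)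
    (hex : ∀ n : ℕ, (SimpleGraph.extremalNumber n H : ℝ) ≤ A * (n : ℝ) ^ a)
    {X : Finset α} {s : ℕ} (hX : X.card ≤ s) {U : Finset (Sym2 α)} (hU : ∀ e ∈ U, ¬ e.IsDiag)
    (hUX : ∀ e ∈ U, ∀ v ∈ e, v ∈ X) (hlt : A * (s : ℝ) ^ a < U.card) :
    ∃ E ⊆ U, IsCopyEdges H E := by
  classical
  set G : SimpleGraph α := SimpleGraph.fromEdgeSet U with hG
  have hGU : G.edgeSet = U := by
    rw [hG, SimpleGraph.edgeSet_fromEdgeSet]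
    ext e; simp only [Set.mem_sdiff, Finset.mem_coe]
    exact ⟨fun h => h.1, fun h => ⟨h, hU e h⟩⟩
  set K := G.induce (X : Set α) with hK
  have himg : Sym2.map Subtype.val '' K.edgeSet = U := by
    ext e
    constructor
    · rintro ⟨e', he', rfl⟩
      induction e' with
      | _ u v =>
        rw [← hGU]
        exact he'
    · intro he
      induction e with
      | _ u v =>
        refine ⟨s(⟨u, hUX _ he u (by simp)⟩, ⟨v, hUX _ he v (by simp)⟩), ?_, rfl⟩
        change s(u, v) ∈ G.edgeSet
        rw [hGU]; exact he
  have hcard : K.edgeFinset.card = U.card := by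
    have h := congrArg Set.ncard himg
    rw [Set.ncard_image_of_injective _ (Sym2.map.injective Subtype.val_injective),
      Set.ncard_coe_finset] at h
    rw [← h, ← Set.ncard_coe_finset, SimpleGraph.coe_edgeFinset]
  have hnf : ¬ H.Free K := by
    intro hfree
    have h1 := SimpleGraph.card_edgeFinset_le_extremalNumber hfree
    rw [hcard] at h1
    have h2 : Fintype.card (X : Set α) = X.card := by simp
    rw [h2] at h1
    have h3 : A * (X.card : ℝ) ^ a ≤ A * (s : ℝ) ^ a := by gcongr
    have h4 : (U.card : ℝ) ≤ SimpleGraph.extremalNumber X.card H := by exact_mod_cast h1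
    linarith [hex X.card]
  rw [SimpleGraph.not_free] at hnf
  obtain ⟨f⟩ := hnf
  set g : W ↪ α := f.toEmbedding.trans (Function.Embedding.subtype _) with hg
  have hsub : Sym2.map g '' H.edgeSet ⊆ U := by
    rintro _ ⟨e, he, rfl⟩
    induction e with
    | _ u v =>
      rw [← hGU]
      exact f.toHom.map_adj he
  exact ⟨U.filter fun e => e ∈ Sym2.map g '' H.edgeSet, Finset.filter_subset _ _, g, by
    ext e
    simp only [Finset.coe_filter, Set.mem_ofPred_eq]
    exact ⟨fun h => h.2, fun h => ⟨hsub h, h⟩⟩⟩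

end Copies

/-! ### Balanced supersaturation by random transversals. -/

/-- Greedily choosing pairwise disjoint members of a family. -/
lemma exists_disjoint_family {α : Type*} [DecidableEq α] {P : Finset α → Prop} {k : ℕ} {a : ℝ}
    (hk : 0 < k) (hP : ∀ E, P E → E.card = k) (U : Finset α)
    (h : ∀ U' ⊆ U, a < U'.card → ∃ E ⊆ U', P E) :
    ∃ 𝓕 : Finset (Finset α), (∀ E ∈ 𝓕, P E ∧ E ⊆ U) ∧
      (∀ E ∈ 𝓕, ∀ E' ∈ 𝓕, ∀ e ∈ E, e ∈ E' → E = E') ∧ (U.card : ℝ) ≤ a + k * 𝓕.card := by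
  induction U using Finset.strongInduction with
  | H U ih =>
    rcases le_or_gt (U.card : ℝ) a with hle | hlt
    · exact ⟨∅, by simp, by simp, by simpa using hle⟩
    obtain ⟨E, hEU, hE⟩ := h U subset_rfl hlt
    have hne : E.Nonempty := Finset.card_pos.1 (by rw [hP E hE]; exact hk)
    obtain ⟨𝓕, h1, h2, h3⟩ := ih (U \ E) (Finset.sdiff_ssubset hEU hne)
      fun U' hU' => h U' (hU'.trans Finset.sdiff_subset)
    have hdisj : ∀ E' ∈ 𝓕, ∀ e ∈ E, e ∉ E' := fun E' hE' e he he' =>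
      (Finset.mem_sdiff.1 ((h1 E' hE').2 he')).2 he
    have hEn : E ∉ 𝓕 := fun hmem => hne.elim fun e he => hdisj E hmem e he he
    refine ⟨insert E 𝓕, ?_, ?_, ?_⟩
    · intro E' hE'
      rcases Finset.mem_insert.1 hE' with rfl | hE'
      · exact ⟨hE, hEU⟩
      · exact ⟨(h1 E' hE').1, (h1 E' hE').2.trans Finset.sdiff_subset⟩
    · intro E₁ hE₁ E₂ hE₂ e he₁ he₂
      rcases Finset.mem_insert.1 hE₁ with rfl | hE₁' <;>
        rcases Finset.mem_insert.1 hE₂ with rfl | hE₂'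
      · rfl
      · exact absurd he₂ (hdisj _ hE₂' e he₁)
      · exact absurd he₁ (hdisj _ hE₁' e he₂)
      · exact h2 _ hE₁' _ hE₂' e he₁ he₂
    · rw [Finset.card_insert_of_notMem hEn]
      have h4 : (U \ E).card + k = U.card := by
        rw [← hP E hE]; exact Finset.card_sdiff_add_card_eq_card hEU
      have h5 : ((U \ E).card : ℝ) + k = U.card := by exact_mod_cast h4
      push_cast; linarith

section Transversals

variable {n s m : ℕ}

/-- The number of transversals containing a set of vertices that lie in distinct blocks. -/
lemma card_transversals_eq (b : Fin n → Fin s) (r : Fin n → Fin m) (Y : Finset (Fin n))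
    (hb : Set.InjOn b Y) :
    (Finset.univ.filter fun φ : Fin s → Fin m => ∀ y ∈ Y, φ (b y) = r y).card * m ^ Y.card =
      m ^ s := by
  classical
  set t : Fin s → Finset (Fin m) := fun i =>
    Finset.univ.filter fun a => ∀ y ∈ Y, b y = i → a = r y with ht
  have h1 : (Finset.univ.filter fun φ : Fin s → Fin m => ∀ y ∈ Y, φ (b y) = r y) =
      Fintype.piFinset t := by
    ext φ
    simp only [Finset.mem_filter, Finset.mem_univ, true_and, Fintype.mem_piFinset, ht]
    exact ⟨fun h i y hy hi => hi ▸ h y hy, fun h y hy => h _ y hy rfl⟩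
  have h2 : ∀ i, (t i).card = if i ∈ Y.image b then 1 else m := by
    intro i
    split_ifs with hi
    · obtain ⟨y, hy, rfl⟩ := Finset.mem_image.1 hi
      rw [Finset.card_eq_one]
      refine ⟨r y, ?_⟩
      ext a
      simp only [ht, Finset.mem_filter, Finset.mem_univ, true_and, Finset.mem_singleton]
      exact ⟨fun h => h y hy rfl, fun h z hz hzy => by rw [hb hz hy hzy]; exact h⟩
    · have : t i = Finset.univ := by
        refine Finset.filter_true_of_mem fun a _ y hy hyi => ?_
        exact absurd (Finset.mem_image.2 ⟨y, hy, hyi⟩) hi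
      rw [this, Finset.card_univ, Fintype.card_fin]
  rw [h1, Fintype.card_piFinset]
  simp_rw [h2]
  rw [Finset.prod_ite, Finset.prod_const_one, one_mul, Finset.prod_const, ← pow_add]
  congr 1
  have h3 := Finset.card_filter_add_card_filter_not (s := (Finset.univ : Finset (Fin s)))
    (fun i => i ∈ Y.image b)
  have h4 : (Finset.univ.filter fun i => i ∈ Y.image b).card = Y.card := by
    rw [Finset.filter_univ_mem, Finset.card_image_of_injOn hb]
  rw [Finset.card_univ, Fintype.card_fin] at h3
  omega

/-- If two vertices of Y share a block, no transversal contains both, so only the injective case has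
anything to count. -/
lemma card_transversals_le (b : Fin n → Fin s) (r : Fin n → Fin m)
    (hbr : Function.Injective fun v => (b v, r v)) (Y : Finset (Fin n)) :
    (Finset.univ.filter fun φ : Fin s → Fin m => ∀ y ∈ Y, φ (b y) = r y).card * m ^ Y.card ≤
      m ^ s := by
  by_cases hb : Set.InjOn b Y
  · exact (card_transversals_eq b r Y hb).le
  · have : (Finset.univ.filter fun φ : Fin s → Fin m => ∀ y ∈ Y, φ (b y) = r y) = ∅ := by
      refine Finset.filter_eq_empty_iff.2 fun φ _ hφ => hb fun y hy z hz hyz => ?_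
      refine hbr (Prod.ext hyz ?_)
      change r y = r z
      rw [← hφ y hy, ← hφ z hz, hyz]
    simp [this]

open Classical in
/-- There are few pairs inside the blocks. -/
lemma card_inside_blocks_le (b : Fin n → Fin s) (r : Fin n → Fin m)
    (hbr : Function.Injective fun v => (b v, r v)) (U : Finset (Sym2 (Fin n))) :
    (U.filter fun e => ¬ Set.InjOn b e.toFinset).card ≤ n * m := by
  have h1 : (U.filter fun e => ¬ Set.InjOn b e.toFinset) ⊆
      (Finset.univ.filter fun x : Fin n × Fin n => b x.1 = b x.2).image
        fun x => s(x.1, x.2) := by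
    intro e he
    have he2 := (Finset.mem_filter.1 he).2
    induction e with
    | _ u v =>
      refine Finset.mem_image.2 ⟨(u, v), ?_, rfl⟩
      simp only [Finset.mem_filter, Finset.mem_univ, true_and]
      by_contra hne
      refine he2 fun x hx y hy hxy => ?_
      simp only [Finset.mem_coe, Sym2.mem_toFinset, Sym2.mem_iff] at hx hy
      rcases hx with rfl | rfl <;> rcases hy with rfl | rfl
      · rfl
      · exact absurd hxy hne
      · exact absurd hxy.symm hne
      · rfl
  refine (Finset.card_le_card h1).trans (Finset.card_image_le.trans ?_)
  have h2 : ((Finset.univ : Finset (Fin n × Fin m))).card = n * m := by simp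
  rw [← h2]
  refine Finset.card_le_card_of_injOn (fun x => (x.1, r x.2)) (fun _ _ => by simp) ?_
  rintro ⟨x, y⟩ hx ⟨x', y'⟩ hx' h
  simp only [Finset.coe_filter, Finset.mem_univ, true_and, Set.mem_ofPred_eq] at hx hx'
  simp only [Prod.mk.injEq] at h
  obtain ⟨rfl, h⟩ := h
  have : y = y' := hbr (Prod.ext (hx.symm.trans hx') h)
  rw [this]

end Transversals

/-- Pairs inside blocks cost at most N/2 and the extremal term at most N/(4m²) per transversal,
leaving N/(4m²) edges for copies of size k. Here Z is the number of transversals and F the total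
number of chosen copies. -/
lemma average_bound {N n m k F Z B : ℝ} (hZ : 0 < Z) (hm : 0 < m) (hk : 0 < k)
    (h1 : 2 * n * m ≤ N) (h2 : 4 * B * m ^ 2 ≤ N)
    (h : Z / m ^ 2 * (N - n * m) ≤ Z * B + k * F) :
    1 / (4 * k) * (1 / m ^ 2) * N * Z ≤ F := by
  have e1 : Z / m ^ 2 * (N / 2) ≤ Z / m ^ 2 * (N - n * m) := by gcongr; linarith
  have e2 : Z * B ≤ Z / m ^ 2 * (N / 4) := by
    rw [div_mul_eq_mul_div, le_div_iff₀ (by positivity), mul_assoc]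
    gcongr
    linarith
  have e3 : Z / m ^ 2 * (N / 4) ≤ k * F := by
    have : Z / m ^ 2 * (N / 2) = Z / m ^ 2 * (N / 4) + Z / m ^ 2 * (N / 4) := by ring
    linarith
  calc 1 / (4 * k) * (1 / m ^ 2) * N * Z = (Z / m ^ 2 * (N / 4)) / k := by field_simp
    _ ≤ (k * F) / k := by gcongr
    _ = F := mul_div_cancel_left₀ F hk.ne'

/-- Averaging edge-disjoint copies of `H` over random transversals of a partition of the vertices
into blocks of size `m` gives a spread weighted hypergraph of copies of `H`. -/
theorem exists_spread_copies {W : Type*} [Finite W] {H : SimpleGraph W} {A a : ℝ} (hA : 0 ≤ A)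
    (ha : 0 ≤ a)
    (hex : ∀ n : ℕ, (SimpleGraph.extremalNumber n H : ℝ) ≤ A * (n : ℝ) ^ a)
    (hμ : 1 ≤ twoDensity H) (hk : 0 < H.edgeSet.ncard) {n s m : ℕ} (hm : 1 ≤ m)
    (hnsm : n ≤ s * m) {U : Finset (Sym2 (Fin n))} (hU : ∀ e ∈ U, ¬ e.IsDiag)
    (hU1 : (2 * n * m : ℝ) ≤ U.card) (hU2 : 4 * A * (s : ℝ) ^ a * m ^ 2 ≤ U.card)
    {q : ℝ} (hq : (m : ℝ) ^ (-(1 / twoDensity H)) ≤ q) :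
    ∃ w : Finset (Sym2 (Fin n)) → ℝ, IsSpread H.edgeSet.ncard U (1 / (m : ℝ) ^ 2) q w ∧
      1 / (4 * (H.edgeSet.ncard : ℝ)) * (1 / (m : ℝ) ^ 2) * U.card ≤ ∑ E, w E ∧
      ∀ E, w E ≠ 0 → IsCopyEdges H E := by
  classical
  set k := H.edgeSet.ncard with hkdef
  set μ := twoDensity H with hμdef
  have hm0 : (0 : ℝ) < m := by exact_mod_cast hm
  have hm1 : (1 : ℝ) ≤ m := by exact_mod_cast hm
  let b : Fin n → Fin s := fun v => ⟨v / m, Nat.div_lt_of_lt_mul (by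
    rw [mul_comm]; exact v.2.trans_le hnsm)⟩
  let r : Fin n → Fin m := fun v => ⟨v % m, Nat.mod_lt _ hm⟩
  have hbr : Function.Injective fun v => (b v, r v) := by
    intro v v' h
    simp only [b, r, Prod.mk.injEq, Fin.mk.injEq] at h
    ext
    rw [← Nat.div_add_mod (v : ℕ) m, ← Nat.div_add_mod (v' : ℕ) m, h.1, h.2]
  let X : (Fin s → Fin m) → Finset (Fin n) := fun φ => Finset.univ.filter fun v => φ (b v) = r v
  have hX : ∀ φ, (X φ).card ≤ s := fun φ => by
    calc (X φ).card ≤ (Finset.univ : Finset (Fin s)).card := by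
          refine Finset.card_le_card_of_injOn b (fun _ _ => by simp) fun v hv v' hv' h => ?_
          simp only [X, Finset.coe_filter, Finset.mem_univ, true_and, Set.mem_ofPred_eq] at hv hv'
          exact hbr (Prod.ext h (by change r v = r v'; rw [← hv, ← hv', h]))
      _ = s := by simp
  let Uφ : (Fin s → Fin m) → Finset (Sym2 (Fin n)) := fun φ =>
    U.filter fun e => ∀ v ∈ e.toFinset, φ (b v) = r v
  have hfam := fun φ => exists_disjoint_family (P := IsCopyEdges H) (k := k)
    (a := A * (s : ℝ) ^ a) hk (fun E hE => hE.card_eq) (Uφ φ) fun U' hU' hlt =>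
      exists_isCopyEdges hA ha hex (hX φ) (fun e he => hU e (Finset.filter_subset _ _ (hU' he)))
        (fun e he v hv => Finset.mem_filter.2 ⟨Finset.mem_univ _,
          (Finset.mem_filter.1 (hU' he)).2 v (Sym2.mem_toFinset.2 hv)⟩) hlt
  choose 𝓕 h𝓕1 h𝓕2 h𝓕3 using hfam
  have h𝓕U : ∀ φ, ∀ E ∈ 𝓕 φ, E ⊆ U := fun φ E hE =>
    (h𝓕1 φ E hE).2.trans (Finset.filter_subset _ _)
  -- The weight of E is the probability that a uniform transversal selects E in its disjoint family.
  set w : Finset (Sym2 (Fin n)) → ℝ := fun E =>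
    (∑ φ, if E ∈ 𝓕 φ then (1 : ℝ) else 0) / (m : ℝ) ^ s with hw
  have hwne : ∀ E, w E ≠ 0 → ∃ φ, E ∈ 𝓕 φ := fun E hE => by
    by_contra! h
    exact hE (by simp [hw, h])
  have hcnt : ∀ Y : Finset (Fin n),
      ((Finset.univ.filter fun φ : Fin s → Fin m => ∀ y ∈ Y, φ (b y) = r y).card : ℝ) ≤
        (m : ℝ) ^ s / (m : ℝ) ^ Y.card := fun Y => by
    rw [le_div_iff₀ (by positivity)]
    exact_mod_cast card_transversals_le b r hbr Y
  refine ⟨w, ⟨fun E => ?_, fun E hE => ?_, fun S hS => ?_⟩, ?_, fun E hE => ?_⟩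
  · exact div_nonneg (Finset.sum_nonneg fun φ _ => by split_ifs <;> simp) (by positivity)
  · obtain ⟨φ, hφ⟩ := hwne E hE
    exact ⟨h𝓕U φ E hφ, (h𝓕1 φ E hφ).1.card_eq⟩
  · by_cases hcopy : ∃ E φ, S ⊆ E ∧ E ∈ 𝓕 φ
    swap
    · have h0 : weightDeg w S = 0 := by
        refine Finset.sum_eq_zero fun E _ => ?_
        split_ifs with hSE
        · by_contra hE
          obtain ⟨φ, hφ⟩ := hwne E hE
          exact hcopy ⟨E, φ, hSE, hφ⟩
        · rfl
      rw [h0]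
      have : 0 ≤ q := le_trans (by positivity) hq
      positivity
    obtain ⟨E₀, φ₀, hSE₀, hE₀⟩ := hcopy
    have hE₀U := h𝓕U φ₀ E₀ hE₀
    have hdens := (h𝓕1 φ₀ E₀ hE₀).1.card_le hSE₀ (fun e he => hU e (hE₀U he)) hS
    have h2 := two_le_card_cover (fun e he => hU e (hE₀U (hSE₀ he))) hS
    -- By disjointness a transversal selects at most one copy containing the nonempty S, and none
    -- unless it contains every vertex covered by S.
    have hdeg : weightDeg w S ≤ ((m : ℝ) ^ s / (m : ℝ) ^ (cover S).card) / (m : ℝ) ^ s := by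
      calc weightDeg w S
          = (∑ φ, ∑ E, if S ⊆ E ∧ E ∈ 𝓕 φ then (1 : ℝ) else 0) / (m : ℝ) ^ s := by
            rw [Finset.sum_comm, Finset.sum_div]
            refine Finset.sum_congr rfl fun E _ => ?_
            by_cases h : S ⊆ E <;> simp [h, hw]
        _ ≤ (∑ φ : Fin s → Fin m, if ∀ y ∈ cover S, φ (b y) = r y then (1 : ℝ) else 0) /
              (m : ℝ) ^ s := by
            gcongr with φ
            rw [Finset.sum_boole]
            split_ifs with hφ
            · have : (Finset.univ.filter fun E => S ⊆ E ∧ E ∈ 𝓕 φ).card ≤ 1 := by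
                rw [Finset.card_le_one]
                intro E hE E' hE'
                simp only [Finset.mem_filter, Finset.mem_univ, true_and] at hE hE'
                obtain ⟨e, he⟩ := hS
                exact h𝓕2 φ E hE.2 E' hE'.2 e (hE.1 he) (hE'.1 he)
              exact_mod_cast this
            · have : (Finset.univ.filter fun E => S ⊆ E ∧ E ∈ 𝓕 φ) = ∅ := by
                refine Finset.filter_eq_empty_iff.2 ?_
                rintro E - ⟨h1, h2⟩
                refine hφ fun y hy => ?_
                obtain ⟨e, he, hye⟩ := mem_cover.1 hy
                exact (Finset.mem_filter.1 ((h𝓕1 φ E h2).2 (h1 he))).2 y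
                  (Sym2.mem_toFinset.2 hye)
              simp [this]
        _ ≤ _ := by
            rw [Finset.sum_boole]
            gcongr
            exact hcnt _
    refine hdeg.trans ?_
    have hexp : ((S.card - 1 : ℕ) : ℝ) / μ ≤ ((cover S).card - 2 : ℕ) := by
      have hc := hS.card_pos
      rw [Nat.cast_sub hc, Nat.cast_sub h2, div_le_iff₀ (by linarith)]
      push_cast; linarith
    have hpow : 1 / (m : ℝ) ^ ((cover S).card - 2) ≤ q ^ (S.card - 1) := by
      calc 1 / (m : ℝ) ^ ((cover S).card - 2)
          = (m : ℝ) ^ (-(((cover S).card - 2 : ℕ) : ℝ)) := by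
            rw [Real.rpow_neg hm0.le, Real.rpow_natCast, one_div]
        _ ≤ (m : ℝ) ^ (-(((S.card - 1 : ℕ) : ℝ) / μ)) :=
            Real.rpow_le_rpow_of_exponent_le hm1 (by linarith)
        _ = ((m : ℝ) ^ (-(1 / μ))) ^ (S.card - 1) := by
            rw [← Real.rpow_natCast ((m : ℝ) ^ (-(1 / μ))), ← Real.rpow_mul hm0.le]
            congr 1; ring
        _ ≤ _ := by gcongr
    calc (m : ℝ) ^ s / (m : ℝ) ^ (cover S).card / (m : ℝ) ^ s
        = 1 / (m : ℝ) ^ 2 * (1 / (m : ℝ) ^ ((cover S).card - 2)) := by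
          have : (m : ℝ) ^ (cover S).card = (m : ℝ) ^ 2 * (m : ℝ) ^ ((cover S).card - 2) := by
            rw [← pow_add]; congr 1; omega
          rw [this]; field_simp
      _ ≤ _ := by gcongr
  · have hsum : ∑ E, w E = (∑ φ, ((𝓕 φ).card : ℝ)) / (m : ℝ) ^ s := by
      rw [← Finset.sum_div, Finset.sum_comm]
      congr 1
      refine Finset.sum_congr rfl fun φ _ => ?_
      rw [Finset.sum_boole, Finset.filter_univ_mem]
    have hlow : ∑ φ, ((Uφ φ).card : ℝ) ≤ (m : ℝ) ^ s * (A * (s : ℝ) ^ a) +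
        k * ∑ φ, ((𝓕 φ).card : ℝ) := by
      refine (Finset.sum_le_sum fun φ _ => h𝓕3 φ).trans ?_
      rw [Finset.sum_add_distrib, Finset.mul_sum, Finset.sum_const, nsmul_eq_mul]
      simp
    have hcross : (m : ℝ) ^ s / (m : ℝ) ^ 2 * (U.card - n * m) ≤ ∑ φ, ((Uφ φ).card : ℝ) := by
      have hin := card_inside_blocks_le b r hbr U
      have hsplit := Finset.card_filter_add_card_filter_not (s := U)
        (fun e => Set.InjOn b e.toFinset)
      set Uc := U.filter fun e => Set.InjOn b e.toFinset with hUc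
      have h1 : (U.card : ℝ) - n * m ≤ Uc.card := by
        have : U.card ≤ Uc.card + n * m := by omega
        have : (U.card : ℝ) ≤ Uc.card + n * m := by exact_mod_cast this
        linarith
      calc (m : ℝ) ^ s / (m : ℝ) ^ 2 * (U.card - n * m)
          ≤ (m : ℝ) ^ s / (m : ℝ) ^ 2 * Uc.card := by gcongr
        _ = ∑ e ∈ Uc, (m : ℝ) ^ s / (m : ℝ) ^ 2 := by
            rw [Finset.sum_const, nsmul_eq_mul, mul_comm]
        _ = ∑ e ∈ Uc, ((Finset.univ.filter fun φ : Fin s → Fin m =>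
              ∀ v ∈ e.toFinset, φ (b v) = r v).card : ℝ) := by
            refine Finset.sum_congr rfl fun e he => ?_
            obtain ⟨heU, hinj⟩ := Finset.mem_filter.1 he
            have := card_transversals_eq b r e.toFinset hinj
            rw [Sym2.card_toFinset_of_not_isDiag e (hU e heU)] at this
            rw [div_eq_iff (by positivity)]
            exact_mod_cast this.symm
        _ ≤ ∑ e ∈ U, ((Finset.univ.filter fun φ : Fin s → Fin m =>
              ∀ v ∈ e.toFinset, φ (b v) = r v).card : ℝ) :=
            Finset.sum_le_sum_of_subset_of_nonneg (Finset.filter_subset _ _)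
              fun _ _ _ => by positivity
        _ = ∑ φ, ((Uφ φ).card : ℝ) := by
            simp_rw [Finset.card_filter, Uφ, Finset.card_filter]
            push_cast
            rw [Finset.sum_comm]
    rw [hsum, le_div_iff₀ (by positivity)]
    exact average_bound (by positivity) hm0 (by exact_mod_cast hk) hU1 (by linarith)
      (hcross.trans hlow)
  · obtain ⟨φ, hφ⟩ := hwne E hE
    exact (h𝓕1 φ E hφ).1

/-! ### Choice of parameters and the union bound. -/

section Bounds

open MeasureTheory

/-- `I` contains no copy of `H`. -/
def CopyFree {W α : Type*} (H : SimpleGraph W) (I : Finset (Sym2 α)) : Prop :=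
  ∀ E : Finset (Sym2 α), IsCopyEdges H E → ¬ E ⊆ I

/-- Ensures that pairs inside blocks are negligible at the supersaturation threshold. -/
lemma mul_le_rpow_mul_rpow {n m α : ℝ} (hm : 0 < m) (hmn : m ≤ n) (hα : 1 ≤ α) :
    n * m ≤ n ^ α * m ^ (2 - α) := by
  have hn : 0 < n := hm.trans_le hmn
  have h1 : m ^ (α - 1) ≤ n ^ (α - 1) := Real.rpow_le_rpow hm.le hmn (by linarith)
  calc n * m = n * (m ^ (α - 1) * m ^ (2 - α)) := by
        rw [← Real.rpow_add hm]; norm_num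
    _ ≤ n * (n ^ (α - 1) * m ^ (2 - α)) := by gcongr
    _ = n ^ α * m ^ (2 - α) := by
        rw [← mul_assoc, ← Real.rpow_one_add' hn.le (by linarith)]; congr 2; ring

/-- One container step for graphs without a copy of `H`, with a fingerprint whose size decreases
polynomially in the number of edges of the ambient graph. -/
theorem exists_copyFree_container {W : Type*} [Finite W] {H : SimpleGraph W} {A α : ℝ}
    (hA : 1 ≤ A)
    (hex : ∀ n : ℕ, (SimpleGraph.extremalNumber n H : ℝ) ≤ A * (n : ℝ) ^ α)
    (hμ : 1 ≤ twoDensity H) (hk : 0 < H.edgeSet.ncard) (hα1 : 1 ≤ α) (hα2 : α < 2) :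
    ∃ δ L : ℝ, 0 < δ ∧ δ < 1 ∧ 0 < L ∧ ∀ n : ℕ, 1 ≤ n → ∀ p M : ℝ, 0 < p → p ≤ 1 →
      M = 16 * A * (n : ℝ) ^ α * (2 * p ^ (-twoDensity H)) ^ (2 - α) →
      ∀ U : Finset (Sym2 (Fin n)), (∀ e ∈ U, ¬ e.IsDiag) → M < U.card →
      ∃ T f : Finset (Sym2 (Fin n)) → Finset (Sym2 (Fin n)), IsFingerprint T f ∧
        ∀ I ⊆ U, CopyFree H I →
          ((T I).card : ℝ) ≤ L * (p * (U.card / M) ^ (-(1 / (twoDensity H * (2 - α)))) * U.card) ∧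
          I ⊆ f I ∧ f I ⊆ U ∧ ((f I).card : ℝ) ≤ (1 - δ) * U.card := by
  classical
  set k := H.edgeSet.ncard with hkdef
  set μ := twoDensity H with hμdef
  have hk' : (0 : ℝ) < k := by exact_mod_cast hk
  obtain ⟨δ, hδ, hδ1, L, hL, hcont⟩ := exists_container.{0} k (1 / (4 * (k : ℝ))) (by positivity)
  refine ⟨δ, L, hδ, hδ1, hL, fun n hn p M hp hp1 hM U hU hMU => ?_⟩
  have hμ0 : 0 < μ := by linarith
  set β := 2 - α with hβ
  have hβ0 : 0 < β := by linarith
  have hn0 : (0 : ℝ) < n := by exact_mod_cast hn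
  set z : ℝ := 16 * A * (n : ℝ) ^ α with hz
  have hz0 : 0 < z := by positivity
  have hpμ : 1 ≤ p ^ (-μ) := Real.one_le_rpow_of_pos_of_le_one_of_nonpos hp hp1 (by linarith)
  have hM0 : 0 < M := by rw [hM]; positivity
  have hN0 : (0 : ℝ) < U.card := hM0.trans hMU
  -- The largest real block size that supersaturation allows, solving 16 A n^α x^(2-α) = |U|. The
  -- threshold M corresponds to x = 2p^(-μ); the 2 there absorbs rounding x down to m ≥ x/2.
  set x : ℝ := (U.card / z) ^ (1 / β) with hx
  have hx0 : 0 < x := by positivity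
  have hxβ : z * x ^ β = U.card := by
    rw [hx, ← Real.rpow_mul (by positivity), one_div_mul_cancel hβ0.ne', Real.rpow_one]
    field_simp
  have hx2 : 2 ≤ x := by
    have h1 : (2 * p ^ (-μ)) ^ β < x ^ β := by
      rw [← mul_lt_mul_iff_right₀ hz0, hxβ, ← hM]; exact hMU
    have h2 := (Real.rpow_lt_rpow_iff (by positivity) hx0.le hβ0).1 h1
    linarith
  have hxn : x ≤ n := by
    rw [← Real.rpow_le_rpow_iff hx0.le hn0.le hβ0, ← mul_le_mul_iff_right₀ hz0, hxβ]
    calc (U.card : ℝ) ≤ n ^ 2 := card_le_sq U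
      _ = 1 * ((n : ℝ) ^ α * (n : ℝ) ^ β) := by
          rw [← Real.rpow_add hn0, hβ]; norm_num
      _ ≤ 16 * A * ((n : ℝ) ^ α * (n : ℝ) ^ β) := by gcongr; linarith
      _ = _ := by rw [hz]; ring
  set m := ⌊x⌋₊ with hm
  have hmx : (m : ℝ) ≤ x := Nat.floor_le hx0.le
  have hxm : x / 2 ≤ m := by
    have := Nat.lt_floor_add_one x
    linarith
  have hm1 : 1 ≤ m := Nat.le_floor (by push_cast; linarith)
  have hm0 : (0 : ℝ) < m := by exact_mod_cast hm1
  have hmn : (m : ℝ) ≤ n := hmx.trans hxn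
  have hzm : z * (m : ℝ) ^ β ≤ U.card := by rw [← hxβ]; gcongr
  have hnm : (n : ℝ) * m ≤ (n : ℝ) ^ α * (m : ℝ) ^ β := mul_le_rpow_mul_rpow hm0 hmn hα1
  have hU1 : (2 * n * m : ℝ) ≤ U.card := by
    refine le_trans ?_ hzm
    calc (2 * n * m : ℝ) = 2 * (n * m) := by ring
      _ ≤ 16 * A * ((n : ℝ) ^ α * (m : ℝ) ^ β) := by gcongr; linarith
      _ = _ := by rw [hz]; ring
  set s := n / m + 1 with hs
  have hnsm : n ≤ s * m := by
    have := Nat.lt_div_mul_add (a := n) hm1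
    rw [hs, add_mul, one_mul]; omega
  have hsn : (s : ℝ) ≤ 2 * (n / m) := by
    have h1 : ((n / m : ℕ) : ℝ) ≤ n / m := Nat.cast_div_le
    have h2 : (1 : ℝ) ≤ n / m := by rw [le_div_iff₀ hm0]; linarith
    rw [hs]; push_cast; linarith
  have hU2 : 4 * A * (s : ℝ) ^ α * (m : ℝ) ^ 2 ≤ U.card := by
    refine le_trans ?_ hzm
    have h2α : (2 : ℝ) ^ α ≤ 4 := by
      calc (2 : ℝ) ^ α ≤ (2 : ℝ) ^ (2 : ℝ) :=
            Real.rpow_le_rpow_of_exponent_le one_le_two hα2.le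
        _ = 4 := by norm_num
    calc 4 * A * (s : ℝ) ^ α * (m : ℝ) ^ 2
        ≤ 4 * A * (2 * (n / m)) ^ α * (m : ℝ) ^ 2 := by gcongr
      _ = 4 * A * (2 ^ α * (n : ℝ) ^ α) * ((m : ℝ) ^ (2 : ℝ) / (m : ℝ) ^ α) := by
          rw [Real.mul_rpow zero_le_two (by positivity), Real.div_rpow hn0.le hm0.le,
            Real.rpow_two]
          ring
      _ = 4 * A * (2 ^ α * (n : ℝ) ^ α) * (m : ℝ) ^ β := by rw [← Real.rpow_sub hm0]
      _ ≤ 4 * A * (4 * (n : ℝ) ^ α) * (m : ℝ) ^ β := by gcongr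
      _ = _ := by rw [hz]; ring
  set q : ℝ := p * (U.card / M) ^ (-(1 / (μ * β))) with hq
  -- The exponent -1/(μβ) is the one that makes the powers of p cancel.
  have hqx : q = (x / 2) ^ (-(1 / μ)) := by
    have h1 : (U.card : ℝ) / M = (x / 2 * p ^ μ) ^ β := by
      have h2 : x / 2 * p ^ μ = x / (2 * p ^ (-μ)) := by
        rw [Real.rpow_neg hp.le]; field_simp
      rw [h2, Real.div_rpow hx0.le (by positivity), hM, ← hxβ, mul_div_mul_left _ _ hz0.ne']
    have h3 : β * -(1 / (μ * β)) = -(1 / μ) := by field_simp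
    have h4 : μ * -(1 / μ) = -1 := by field_simp
    rw [hq, h1, ← Real.rpow_mul (by positivity), h3, Real.mul_rpow (by positivity) (by positivity),
      ← Real.rpow_mul hp.le, h4, Real.rpow_neg_one]
    field_simp
  have hq0 : 0 < q := by rw [hqx]; positivity
  have hμ1 : 1 / μ ≤ 1 := by rw [div_le_one hμ0]; exact hμ
  have hmq : (m : ℝ) ^ (-(1 / μ)) ≤ q := by
    rw [hqx]
    exact Real.rpow_le_rpow_of_nonpos (by positivity) hxm (by simp; positivity)
  have hqU : 1 ≤ q * U.card := by
    have h1 : (n : ℝ)⁻¹ ≤ q := by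
      refine le_trans ?_ hmq
      calc (n : ℝ)⁻¹ ≤ (m : ℝ)⁻¹ := by gcongr
        _ = (m : ℝ) ^ (-1 : ℝ) := (Real.rpow_neg_one _).symm
        _ ≤ _ := Real.rpow_le_rpow_of_exponent_le (by exact_mod_cast hm1) (by linarith)
    have h2 : (n : ℝ) ≤ U.card := by
      have : (1 : ℝ) ≤ m := by exact_mod_cast hm1
      nlinarith
    calc (1 : ℝ) = (n : ℝ)⁻¹ * n := by field_simp
      _ ≤ q * U.card := by gcongr
  obtain ⟨w, hw1, hw2, hw3⟩ := exists_spread_copies (by linarith) (by linarith) hex hμ hk hm1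
    hnsm hU hU1 hU2 hmq
  obtain ⟨T, f, h⟩ := hcont (Sym2 (Fin n)) U (1 / (m : ℝ) ^ 2) q w hq0 (by positivity) hqU hw1 hw2
  refine ⟨T, f, h.toIsFingerprint, fun I hI hIf => h.spec I hI fun E hE => ?_⟩
  by_contra hne
  exact hIf E (hw3 E hne) hE

/-- The supremum is attained: the edgeless graph is H-free because H has an edge, and G has finitely
many edges. -/
lemma relEx_spec {W V : Type*} [Finite W] (G : SimpleGraph W) {H : SimpleGraph V}
    (hH : H ≠ ⊥) : ∃ G' : SimpleGraph W, G' ≤ G ∧ H.Free G' ∧ G'.edgeSet.ncard = relEx G H := by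
  have hne : {m : ℕ | ∃ G' : SimpleGraph W, G' ≤ G ∧ H.Free G' ∧ G'.edgeSet.ncard = m}.Nonempty :=
    ⟨_, ⊥, bot_le, SimpleGraph.free_bot hH, rfl⟩
  refine Nat.sSup_mem hne ⟨G.edgeSet.ncard, ?_⟩
  rintro _ ⟨G', hG', -, rfl⟩
  exact Set.ncard_le_ncard (SimpleGraph.edgeSet_mono hG') (Set.toFinite _)

lemma relEx_le_ncard {W V : Type*} [Finite W] (G : SimpleGraph W) {H : SimpleGraph V}
    (hH : H ≠ ⊥) : relEx G H ≤ G.edgeSet.ncard := by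
  obtain ⟨G', h1, -, h3⟩ := relEx_spec G hH
  rw [← h3]
  exact Set.ncard_le_ncard (SimpleGraph.edgeSet_mono h1) (Set.toFinite _)

lemma relEx_le_extremalNumber {V : Type*} {n : ℕ} (G : SimpleGraph (Fin n)) {H : SimpleGraph V}
    (hH : H ≠ ⊥) : relEx G H ≤ SimpleGraph.extremalNumber n H := by
  classical
  obtain ⟨G', -, h2, h3⟩ := relEx_spec G hH
  have := SimpleGraph.card_edgeFinset_le_extremalNumber h2
  rwa [Fintype.card_fin, ← Set.ncard_coe_finset, SimpleGraph.coe_edgeFinset, h3] at this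

/-- Holds because 2 log 2 > 1. -/
lemma two_rpow_neg_mul_exp_le {c Q : ℝ} (hQ : 0 ≤ Q) (hc : 0 ≤ c) :
    (2 : ℝ) ^ (-(2 * (c + 1) * Q)) * Real.exp (c * Q) ≤ Real.exp (-Q) := by
  rw [Real.rpow_def_of_pos two_pos, ← Real.exp_add]
  refine Real.exp_le_exp.2 ?_
  have h := Real.log_two_gt_d9
  have : 0 ≤ (c + 1) * Q := by positivity
  nlinarith

lemma measureReal_lt_relEx_le_of_mul_sq_le {V : Type*} {H : SimpleGraph V} (hH : H ≠ ⊥) {n : ℕ}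
    (p : unitInterval) {Q B : ℝ} (hpQ : (p : ℝ) * n ^ 2 ≤ Q) (hnQ : n ≤ Q) (hB : 4 * Q ≤ B) :
    G(Fin n, p).real {G : SimpleGraph (Fin n) | B < relEx G H} ≤ Real.exp (-n) := by
  have hQ : 0 ≤ Q := le_trans (Nat.cast_nonneg n) hnQ
  calc G(Fin n, p).real {G : SimpleGraph (Fin n) | B < relEx G H}
      ≤ G(Fin n, p).real {G : SimpleGraph (Fin n) | 4 * Q ≤ G.edgeSet.ncard} := by
        refine measureReal_mono fun G (hG : B < relEx G H) => ?_
        have h1 : (relEx G H : ℝ) ≤ G.edgeSet.ncard := by exact_mod_cast relEx_le_ncard G hH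
        exact hB.trans (hG.le.trans h1)
    _ ≤ 2 ^ (-(4 * Q)) * Real.exp (p * n ^ 2) := measureReal_edges_le n p _
    _ ≤ 2 ^ (-(2 * (1 + 1) * Q)) * Real.exp (1 * Q) := by
        rw [one_mul]; gcongr <;> norm_num
    _ ≤ Real.exp (-Q) := two_rpow_neg_mul_exp_le hQ zero_le_one
    _ ≤ _ := by gcongr

/-- The union bound over a family of containers. -/
lemma measureReal_lt_relEx_le_of_family {V : Type*} {H : SimpleGraph V} (hH : H ≠ ⊥) {n : ℕ}
    (p : unitInterval) {ι : Type*} [Fintype ι] {T C : ι → Finset (Sym2 (Fin n))}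
    {M c₁ c₂ : ℝ} (hc₂ : 0 ≤ c₂) (hM : 0 ≤ M)
    (hTC : ∀ i, (∀ e ∈ T i, ¬ e.IsDiag) ∧ (∀ e ∈ C i, ¬ e.IsDiag) ∧ Disjoint (T i) (C i) ∧
      ((C i).card : ℝ) ≤ M ∧ ((T i).card : ℝ) ≤ c₁ * (p * M))
    (hsum : ∑ i, (p : ℝ) ^ (T i).card ≤ Real.exp (c₂ * (p * M)))
    (hcov : ∀ I : Finset (Sym2 (Fin n)), (∀ e ∈ I, ¬ e.IsDiag) → CopyFree H I →
      ∃ i, T i ⊆ I ∧ I ⊆ T i ∪ C i) :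
    G(Fin n, p).real {G : SimpleGraph (Fin n) |
      (c₁ + 2 * (c₂ + 2)) * (p * M) < relEx G H} ≤ Real.exp (-(p * M)) := by
  classical
  have hp0 : (0 : ℝ) ≤ p := p.2.1
  -- The tail must beat both exp(c₂ pM) from the fingerprints and exp(pM) from the exponential
  -- moment. The remaining c₁ pM edges may lie in the fingerprint.
  set b : ℝ := 2 * ((c₂ + 1) + 1) * (p * M) with hb
  have hsub : {G : SimpleGraph (Fin n) | (c₁ + 2 * (c₂ + 2)) * (p * M) < relEx G H} ⊆
      ⋃ i, {G : SimpleGraph (Fin n) | (T i : Set (Sym2 (Fin n))) ⊆ G.edgeSet ∧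
        b ≤ ((C i : Set (Sym2 (Fin n))) ∩ G.edgeSet).ncard} := by
    intro G (hG : (c₁ + 2 * (c₂ + 2)) * (p * M) < relEx G H)
    obtain ⟨G', h1, h2, h3⟩ := relEx_spec G hH
    have h4 : (G'.edgeFinset : Set (Sym2 (Fin n))) ⊆ G.edgeSet := by
      rw [SimpleGraph.coe_edgeFinset]; exact SimpleGraph.edgeSet_mono h1
    obtain ⟨i, h5, h6⟩ := hcov G'.edgeFinset
      (fun e he => G'.not_isDiag_of_mem_edgeFinset he) fun E hE hsub => hE.not_free (by
        rw [← SimpleGraph.coe_edgeFinset]; exact_mod_cast hsub) h2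
    refine Set.mem_iUnion.2 ⟨i, (Finset.coe_subset.2 h5).trans h4, ?_⟩
    have h7 : G'.edgeFinset.card ≤ (T i).card +
        ((C i : Set (Sym2 (Fin n))) ∩ G.edgeSet).ncard := by
      have h8 : G'.edgeFinset ⊆ T i ∪ (C i ∩ G.edgeFinset) := fun e he => by
        rcases Finset.mem_union.1 (h6 he) with h | h
        · exact Finset.mem_union_left _ h
        · exact Finset.mem_union_right _
            (Finset.mem_inter.2 ⟨h, SimpleGraph.mem_edgeFinset.2 (h4 he)⟩)
      refine (Finset.card_le_card h8).trans ((Finset.card_union_le _ _).trans ?_)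
      rw [← SimpleGraph.coe_edgeFinset, ← Finset.coe_inter, Set.ncard_coe_finset]
    rw [← Set.ncard_coe_finset, SimpleGraph.coe_edgeFinset, h3] at h7
    have h9 : (relEx G H : ℝ) ≤ (T i).card +
        ((C i : Set (Sym2 (Fin n))) ∩ G.edgeSet).ncard := by exact_mod_cast h7
    have h10 := (hTC i).2.2.2.2
    rw [hb]
    linarith
  calc _ ≤ _ := measureReal_mono hsub
    _ ≤ ∑ i, G(Fin n, p).real {G : SimpleGraph (Fin n) | (T i : Set (Sym2 (Fin n))) ⊆ G.edgeSet ∧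
          b ≤ ((C i : Set (Sym2 (Fin n))) ∩ G.edgeSet).ncard} := measureReal_iUnion_fintype_le _
    _ ≤ ∑ i, (p : ℝ) ^ (T i).card * (2 ^ (-b) * Real.exp (p * M)) := by
        refine Finset.sum_le_sum fun i _ => ?_
        obtain ⟨a1, a2, a3, a4, -⟩ := hTC i
        refine (measureReal_fingerprint_le p a1 a2 a3 b).trans ?_
        gcongr
    _ ≤ Real.exp (c₂ * (p * M)) * (2 ^ (-b) * Real.exp (p * M)) := by
        rw [← Finset.sum_mul]; gcongr
    _ = 2 ^ (-b) * Real.exp ((c₂ + 1) * (p * M)) := by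
        rw [add_mul, one_mul, Real.exp_add]; ring
    _ ≤ _ := two_rpow_neg_mul_exp_le (by positivity) (by positivity)

/-- The two regimes agree at p = n^(-1/μ), and the exponent of p is nonnegative. -/
lemma rpow_two_sub_le {n p μ α : ℝ} (hn : 1 ≤ n) (hμ : 1 ≤ μ) (hp : n ^ (-(1 / μ)) ≤ p)
    (h : 2 - 1 / μ ≤ α) : n ^ (2 - 1 / μ) ≤ p ^ (1 - μ * (2 - α)) * n ^ α := by
  have hn0 : 0 < n := by linarith
  have hμ0 : 0 < μ := by linarith
  have he : 0 ≤ 1 - μ * (2 - α) := by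
    have h1 : μ * (2 - α) ≤ μ * (1 / μ) := by gcongr; linarith
    rw [mul_one_div_cancel hμ0.ne'] at h1
    linarith
  calc n ^ (2 - 1 / μ) = (n ^ (-(1 / μ))) ^ (1 - μ * (2 - α)) * n ^ α := by
        rw [← Real.rpow_mul hn0.le, ← Real.rpow_add hn0]
        congr 1; field_simp; ring
    _ ≤ _ := by gcongr

lemma le_rpow_two_sub {n μ : ℝ} (hn : 1 ≤ n) (hμ : 1 ≤ μ) : n ≤ n ^ (2 - 1 / μ) := by
  have : 1 / μ ≤ 1 := by rw [div_le_one (by linarith)]; exact hμ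
  exact Real.self_le_rpow_of_one_le hn (by linarith)

/-- The main range: `2 - 1 / m₂(H) < α < 2` and `p > n ^ (-1 / m₂(H))`. -/
theorem exists_measureReal_lt_relEx_le {W : Type*} [Finite W] {H : SimpleGraph W} {A α : ℝ}
    (hA : 1 ≤ A) (hex : ∀ n : ℕ, (SimpleGraph.extremalNumber n H : ℝ) ≤ A * (n : ℝ) ^ α)
    (hμ : 1 ≤ twoDensity H) (hH : H ≠ ⊥) (hα1 : 2 - 1 / twoDensity H < α) (hα2 : α < 2) :
    ∃ C : ℝ, 0 < C ∧ ∀ n : ℕ, 1 ≤ n → ∀ p : unitInterval,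
      (n : ℝ) ^ (-(1 / twoDensity H)) < p →
      G(Fin n, p).real {G : SimpleGraph (Fin n) |
        C * (p : ℝ) ^ (1 - twoDensity H * (2 - α)) * (n : ℝ) ^ α < relEx G H} ≤
          Real.exp (-n) := by
  classical
  have hk : 0 < H.edgeSet.ncard := by
    rw [Set.ncard_pos (Set.toFinite _)]
    exact SimpleGraph.edgeSet_nonempty.2 hH
  set μ := twoDensity H with hμdef
  have hμ0 : 0 < μ := by linarith
  have hμ1 : 1 / μ ≤ 1 := by rw [div_le_one hμ0]; exact hμ
  obtain ⟨δ, L, hδ, hδ1, hL, hstep⟩ :=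
    exists_copyFree_container hA hex hμ hk (by linarith) hα2
  rw [← hμdef] at hstep
  set β := 2 - α with hβ
  have hβ0 : 0 < β := by linarith
  have hμβ : μ * β < 1 := by
    have : μ * β < μ * (1 / μ) := by gcongr; linarith
    rwa [mul_one_div_cancel hμ0.ne'] at this
  set l := 1 / (μ * β) with hl
  have hl1 : 1 < l := by rw [hl, lt_div_iff₀ (by positivity)]; linarith
  -- Here l = λ, and l > 1 is exactly what makes the fingerprint sizes summable; half of the surplus
  -- pays for the entropy.
  set ε := (l - 1) / 2 with hε
  have hε0 : 0 < ε := by rw [hε]; linarith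
  have hx1 : (1 - δ) ^ ε < 1 := Real.rpow_lt_one (by linarith) (by linarith) hε0
  set c₁ := L / (1 - (1 - δ) ^ ε) with hc₁
  set c₂ := (l * L / ε + 1) / (1 - (1 - δ) ^ ε) with hc₂
  have hx1' : 0 < 1 - (1 - δ) ^ ε := by linarith
  have hc₁0 : 0 < c₁ := by positivity
  have hc₂0 : 0 < c₂ := by positivity
  refine ⟨(c₁ + 2 * (c₂ + 2)) * (16 * A * 2 ^ β), by positivity, fun n hn p hp => ?_⟩
  have hn1 : (1 : ℝ) ≤ n := by exact_mod_cast hn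
  have hn0 : (0 : ℝ) < n := by linarith
  have hp0 : (0 : ℝ) < p := lt_trans (by positivity) hp
  set M : ℝ := 16 * A * (n : ℝ) ^ α * (2 * (p : ℝ) ^ (-μ)) ^ β with hM
  have hM0 : 0 < M := by positivity
  have hpM : (p : ℝ) * M = 16 * A * 2 ^ β * ((p : ℝ) ^ (1 - μ * β) * (n : ℝ) ^ α) := by
    rw [hM, Real.mul_rpow zero_le_two (by positivity), ← Real.rpow_mul hp0.le, sub_eq_add_neg,
      Real.rpow_add hp0, Real.rpow_one, neg_mul]
    ring
  have hnpM : (n : ℝ) ≤ p * M := by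
    have h1 := (le_rpow_two_sub hn1 hμ).trans (rpow_two_sub_le hn1 hμ hp.le hα1.le)
    rw [hpM]
    have h2 : (1 : ℝ) ≤ 2 ^ β := Real.one_le_rpow one_le_two hβ0.le
    calc (n : ℝ) ≤ 1 * ((p : ℝ) ^ (1 - μ * β) * (n : ℝ) ^ α) := by rw [one_mul]; exact h1
      _ ≤ _ := by gcongr; nlinarith
  set E : Finset (Sym2 (Fin n)) := Finset.univ.filter fun e => ¬ e.IsDiag with hE
  have hdiag : ∀ S ⊆ E, ∀ e ∈ S, ¬ e.IsDiag := fun S hS e he => by simpa [hE] using hS he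
  obtain ⟨ι, hι, T, C, h1, h2, h3⟩ := exists_container_family
    (ind := CopyFree H) (fun I J hJI hI F hF hFJ => hI F hF (hFJ.trans hJI))
    hM0 hp0 hδ hδ1 hL hε0 (by rw [hε]; ring : l = 1 + 2 * ε) (E := E) (fun U hUE hMU => by
      obtain ⟨T, f, hTf, h⟩ := hstep n hn p M hp0 p.2.2 hM U (hdiag U hUE) hMU
      exact ⟨T, f, hTf, h⟩)
  have := measureReal_lt_relEx_le_of_family hH p hc₂0.le hM0.le (fun i => by
    obtain ⟨a1, a2, a3, a4, a5⟩ := h1 i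
    exact ⟨hdiag _ a1, hdiag _ a2, a3, a4, a5⟩) h2 (fun I hI hIf =>
      h3 I (fun e he => by simpa [hE] using hI e he) hIf)
  calc _ = _ := by rw [mul_assoc, mul_assoc, ← hpM]
    _ ≤ _ := this
    _ ≤ _ := by gcongr

end Bounds

open MeasureTheory in
/-- The bound on `ex(G(n, p), H)`, with an explicit failure probability. -/
theorem exists_measureReal_not_relEx_le {W : Type*} [Finite W] {H : SimpleGraph W} {A α : ℝ}
    (hA : 1 ≤ A) (hex : ∀ n : ℕ, (SimpleGraph.extremalNumber n H : ℝ) ≤ A * (n : ℝ) ^ α)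
    (hμ : 1 ≤ twoDensity H) (hH : H ≠ ⊥) :
    ∃ C : ℝ, 0 < C ∧ ∀ n : ℕ, 1 ≤ n → ∀ p : unitInterval,
      G(Fin n, p).real {G : SimpleGraph (Fin n) | (relEx G H : ℝ) ≤
        if (p : ℝ) ≤ (n : ℝ) ^ (-(1 / twoDensity H)) then
          C * (n : ℝ) ^ (2 - 1 / twoDensity H)
        else C * (p : ℝ) ^ (1 - 1 / lam α H) * (n : ℝ) ^ α}ᶜ ≤ Real.exp (-n) := by
  have hlam : 1 / lam α H = twoDensity H * (2 - α) := by rw [lam, one_div_one_div]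
  rw [hlam]
  simp only [Set.compl_ofPred, not_le]
  set μ := twoDensity H with hμdef
  have hμ0 : 0 < μ := by linarith
  obtain ⟨C, hC, hmain⟩ : ∃ C : ℝ, 0 < C ∧ ∀ n : ℕ, 1 ≤ n → ∀ p : unitInterval,
      (n : ℝ) ^ (-(1 / μ)) < p → G(Fin n, p).real {G : SimpleGraph (Fin n) |
        C * (p : ℝ) ^ (1 - μ * (2 - α)) * (n : ℝ) ^ α < relEx G H} ≤ Real.exp (-n) := by
    rcases le_or_gt α (2 - 1 / μ) with h1 | h1
    -- The exponent of p is nonpositive here, so the deterministic bound makes the bad event empty.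
    · refine ⟨A, by linarith, fun n hn p hp => ?_⟩
      have hn1 : (1 : ℝ) ≤ n := by exact_mod_cast hn
      have hp0 : (0 : ℝ) < p := lt_trans (by positivity) hp
      have he : 1 - μ * (2 - α) ≤ 0 := by
        have : μ * (1 / μ) ≤ μ * (2 - α) := by gcongr; linarith
        rw [mul_one_div_cancel hμ0.ne'] at this
        linarith
      have hp1 : 1 ≤ (p : ℝ) ^ (1 - μ * (2 - α)) :=
        Real.one_le_rpow_of_pos_of_le_one_of_nonpos hp0 p.2.2 he
      have hempty : {G : SimpleGraph (Fin n) |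
          A * (p : ℝ) ^ (1 - μ * (2 - α)) * (n : ℝ) ^ α < relEx G H} = ∅ := by
        refine Set.eq_empty_of_forall_notMem fun G (hG : _ < (relEx G H : ℝ)) => ?_
        have h2 : (relEx G H : ℝ) ≤ SimpleGraph.extremalNumber n H := by
          exact_mod_cast relEx_le_extremalNumber G hH
        have h3 : A * 1 * (n : ℝ) ^ α ≤ A * (p : ℝ) ^ (1 - μ * (2 - α)) * (n : ℝ) ^ α := by
          gcongr
        linarith [hex n]
      rw [hempty, measureReal_empty]
      positivity
    rcases lt_or_ge α 2 with h2 | h2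
    · exact exists_measureReal_lt_relEx_le hA hex hμ hH h1 h2
    -- For α ≥ 2 and p above the threshold, p n² is at most the target, so counting all edges
    -- suffices.
    · refine ⟨4, by norm_num, fun n hn p hp => ?_⟩
      have hn1 : (1 : ℝ) ≤ n := by exact_mod_cast hn
      have hn0 : (0 : ℝ) < n := by linarith
      have hp0 : (0 : ℝ) < p := lt_trans (by positivity) hp
      refine measureReal_lt_relEx_le_of_mul_sq_le hH p
        (Q := (p : ℝ) ^ (1 - μ * (2 - α)) * (n : ℝ) ^ α) ?_ ?_ (by rw [mul_assoc])
      · have h3 : ((n : ℝ) ^ (-(1 / μ))) ^ (μ * (α - 2)) ≤ (p : ℝ) ^ (μ * (α - 2)) :=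
          Real.rpow_le_rpow (by positivity) hp.le (mul_nonneg hμ0.le (by linarith))
        have h4 : ((n : ℝ) ^ (-(1 / μ))) ^ (μ * (α - 2)) = (n : ℝ) ^ (2 - α) := by
          rw [← Real.rpow_mul hn0.le]; congr 1; field_simp; ring
        calc (p : ℝ) * n ^ 2 = p * ((n : ℝ) ^ (2 - α) * (n : ℝ) ^ α) := by
              rw [← Real.rpow_add hn0]; norm_num
          _ ≤ p * ((p : ℝ) ^ (μ * (α - 2)) * (n : ℝ) ^ α) := by
              rw [← h4]; gcongr
          _ = _ := by
              have : 1 - μ * (2 - α) = 1 + μ * (α - 2) := by ring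
              rw [this, Real.rpow_add hp0, Real.rpow_one]; ring
      · exact (le_rpow_two_sub hn1 hμ).trans (rpow_two_sub_le hn1 hμ hp.le h1.le)
  refine ⟨max C 4, by positivity, fun n hn p => ?_⟩
  have hn1 : (1 : ℝ) ≤ n := by exact_mod_cast hn
  have hn0 : (0 : ℝ) < n := by linarith
  split_ifs with hp
  · refine measureReal_lt_relEx_le_of_mul_sq_le hH p (Q := (n : ℝ) ^ (2 - 1 / μ)) ?_
      (le_rpow_two_sub hn1 hμ) (by gcongr; exact le_max_right _ _)
    calc (p : ℝ) * n ^ 2 ≤ (n : ℝ) ^ (-(1 / μ)) * (n : ℝ) ^ (2 : ℝ) := by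
          rw [Real.rpow_two]; gcongr
      _ = _ := by rw [← Real.rpow_add hn0]; congr 1; ring
  · refine le_trans (measureReal_mono fun G (hG : _ < (relEx G H : ℝ)) => ?_)
      (hmain n hn p (not_le.1 hp))
    refine lt_of_le_of_lt ?_ hG
    have : (0 : ℝ) ≤ p := p.2.1
    gcongr
    exact le_max_left _ _

end RandomTuran

theorem theorem2p3 {V : Type*} [Finite V] (H : SimpleGraph V)
    (hbip : H.IsBipartite) (hcyc : ¬ H.IsAcyclic) (α : ℝ) (hα : 0 < α) :
    ∃ C : ℝ, 0 < C ∧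
      ∀ A : ℝ, 0 < A →
        (∀ n : ℕ, (SimpleGraph.extremalNumber n H : ℝ) ≤ A * (n : ℝ) ^ α) →
        ∀ p : ℕ → unitInterval,
          Tendsto
            (fun n : ℕ => G(Fin n, p n)
              {G : SimpleGraph (Fin n) |
                (RandomTuran.relEx G H : ℝ) ≤
                  if (p n : ℝ) ≤ (n : ℝ) ^ (-(1 / RandomTuran.twoDensity H)) then
                    C * (n : ℝ) ^ (2 - 1 / RandomTuran.twoDensity H)
                  else
                    C * (p n : ℝ) ^ (1 - 1 / RandomTuran.lam α H) * (n : ℝ) ^ α})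
            atTop (𝓝 1) := by
  -- Fixing one admissible A₀ in advance, if any exists, makes C depend only on α and H and not on
  -- the A supplied later.
  by_cases hAex : ∃ A : ℝ, 0 < A ∧
      ∀ n : ℕ, (SimpleGraph.extremalNumber n H : ℝ) ≤ A * (n : ℝ) ^ α
  swap
  · exact ⟨1, one_pos, fun A hA hex => absurd ⟨A, hA, hex⟩ hAex⟩
  obtain ⟨A₀, hA₀, hex₀⟩ := hAex
  have hH : H ≠ ⊥ := fun h => hcyc (h ▸ SimpleGraph.isAcyclic_bot)
  obtain ⟨C, hC, hbound⟩ := RandomTuran.exists_measureReal_not_relEx_le (A := max A₀ 1) (α := α)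
    (le_max_right _ _) (fun n => (hex₀ n).trans (by gcongr; exact le_max_left _ _))
    (RandomTuran.one_le_twoDensity hcyc) hH
  refine ⟨C, hC, fun A _ _ p => ?_⟩
  have hlim : Tendsto (fun n : ℕ => 1 - ENNReal.ofReal (Real.exp (-n))) atTop (𝓝 1) := by
    have h1 : Tendsto (fun n : ℕ => ENNReal.ofReal (Real.exp (-n))) atTop (𝓝 0) := by
      rw [← ENNReal.ofReal_zero]
      exact ENNReal.tendsto_ofReal
        (Real.tendsto_exp_neg_atTop_nhds_zero.comp tendsto_natCast_atTop_atTop)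
    have h2 := ENNReal.Tendsto.sub (tendsto_const_nhds (x := (1 : ENNReal)) (f := atTop)) h1
      (Or.inl ENNReal.one_ne_top)
    rwa [tsub_zero] at h2
  refine tendsto_of_tendsto_of_tendsto_of_le_of_le' hlim tendsto_const_nhds ?_
    (Eventually.of_forall fun n => MeasureTheory.prob_le_one)
  filter_upwards [eventually_ge_atTop 1] with n hn
  have h1 := hbound n hn (p n)
  generalize hS : {G : SimpleGraph (Fin n) | (RandomTuran.relEx G H : ℝ) ≤ _} = S at h1 ⊢
  have h2 : G(Fin n, p n) Sᶜ ≤ ENNReal.ofReal (Real.exp (-n)) := by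
    rw [← MeasureTheory.ofReal_measureReal]
    exact ENNReal.ofReal_le_ofReal h1
  rw [tsub_le_iff_right]
  calc (1 : ENNReal) = G(Fin n, p n) Set.univ := MeasureTheory.measure_univ.symm
    _ = G(Fin n, p n) (S ∪ Sᶜ) := by rw [Set.union_compl_self]
    _ ≤ G(Fin n, p n) S + G(Fin n, p n) Sᶜ := MeasureTheory.measure_union_le _ _
    _ ≤ _ := by gcongr
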